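/- Let $\mathcal{R}$ be a commutative unital ring, let $G$ be a groupoid (a small category in which every morphism is invertible; $G$ also denotes its set of morphisms, $G_0\subseteq G$ its set of objects, identified with the identity morphisms, $s,r\colon G\to G_0$ the source and range maps, and $gh$ is defined if and only if $s(g)=r(h)$), and let $X$ be a locally compact, Hausdorff, zero-dimensional topological space (zero-dimensional: the clopen sets form a base of the topology). Let $\theta=(X_g,\theta_g)_{g\in G}$ be a topological partial action of $G$ on $X$, that is, each $X_g\subseteq X$ is open, each $\theta_g\colon X_{g^{-1}}\to X_g$ is a homeomorphism, and (i) $X_g\subseteq X_{r(g)}$ for all $g\in G$; (ii) $\theta_e=\mathrm{id}_{X_e}$ for all $e\in G_0$; (iii) $\theta_h^{-1}(X_{g^{-1}}\cap X_h)\subseteq X_{(gh)^{-1}}$ whenever $s(g)=r(h)$; (iv) $\theta_g(\theta_h(x))=\theta_{gh}(x)$ whenever $s(g)=r(h)$ and $x\in\theta_h^{-1}(X_{g^{-1}}\cap X_h)$. Suppose that $X_g$ is clopen for every $g\in G$ and that $X=\bigsqcup_{e\in G_0}X_e$. Let $\mathcal{L}_c(X,\mathcal{R})$ be the $\mathcal{R}$-algebra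 of all locally constant functions $f\colon X\to\mathcal{R}$ with compact support $\operatorname{supp}(f)=\{x: f(x)\ne 0\}$, with pointwise operations. Let $\alpha=(D_g,\alpha_g)_{g\in G}$ be the induced partial action of $G$ on $\mathcal{L}_c(X,\mathcal{R})$: $D_g=\{f:\operatorname{supp}(f)\subseteq X_g\}$, and $\alpha_g\colon D_{g^{-1}}\to D_g$ is given by $\alpha_g(f)(x)=f(\theta_{g^{-1}}(x))$ for $x\in X_g$ and $\alpha_g(f)(x)=0$ for $x\notin X_g$. Let $\mathcal{L}_c(X,\mathcal{R})\rtimes_\alpha G$ be the partial skew groupoid ring, that is, the $\mathcal{R}$-module of all formal finite sums $\sum_{g\in G}a_g\delta_g$ with $a_g\in D_g$, with the bilinear multiplication determined by $a_g\delta_g\cdot b_h\delta_h=\alpha_g(\alpha_{g^{-1}}(a_g)b_h)\delta_{gh}$ if $s(g)=r(h)$, and $a_g\delta_g\cdot b_h\delta_h=0$ otherwise. Let $G\rtimes_\theta X=\{(t,x): t\in G,\ x\in X_{t^{-1}}\}$ be the transformation groupoid, with the topology induced by the product topology of $G\times X$ ($G$ discrete), with source $(s(t),x)$ and range $(r(t),\theta_t(x))$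 of $(t,x)$, product $(v,\theta_t(x))(t,x)=(vt,x)$ and inverse $(t,x)^{-1}=(t^{-1},\theta_t(x))$. Let $A_{\mathcal{R}}(G\rtimes_\theta X)$ be its Steinberg algebra, that is, the $\mathcal{R}$-module of all locally constant functions $G\rtimes_\theta X\to\mathcal{R}$ with compact support, with the convolution product $(f_1*f_2)(\gamma)=\sum_{\alpha\beta=\gamma}f_1(\alpha)f_2(\beta)$. Then $\mathcal{L}_c(X,\mathcal{R})\rtimes_\alpha G$ and $A_{\mathcal{R}}(G\rtimes_\theta X)$ are isomorphic as (not necessarily unital) $\mathcal{R}$-algebras. -/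

import Mathlib

open CategoryTheory Topology

noncomputable section

/-! ### Groupoids -/

/-- The set of all morphisms of a small category. -/
abbrev Arrows (C : Type*) [Quiver C] := Quiver.Total C

namespace Arrows

variable {C : Type*} [Groupoid C]

/-- The source of a morphism. -/
abbrev source (g : Arrows C) : C := g.left

/-- The range (codomain) of a morphism. -/
abbrev range (g : Arrows C) : C := g.right

/-- The identity morphism of an object. -/
def unit (e : C) : Arrows C := ⟨e, e, 𝟙 e⟩

/-- The inverse of a morphism. -/
def inv (g : Arrows C) : Arrows C := ⟨g.right, g.left, Groupoid.inv g.hom⟩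

/-- The product `gh` of a composable pair: first `h`, then `g`. -/
def comp (g h : Arrows C) (p : g.source = h.range) : Arrows C :=
  ⟨h.left, g.right, h.hom ≫ eqToHom p.symm ≫ g.hom⟩

@[simp] theorem unit_left (e : C) : (unit e).left = e := rfl
@[simp] theorem unit_right (e : C) : (unit e).right = e := rfl
@[simp] theorem inv_left (g : Arrows C) : g.inv.left = g.right := rfl
@[simp] theorem inv_right (g : Arrows C) : g.inv.right = g.left := rfl
@[simp] theorem comp_left (g h : Arrows C) (p) : (comp g h p).left = h.left := rfl
@[simp] theorem comp_right (g h : Arrows C) (p) : (comp g h p).right = g.right := rfl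

@[simp] theorem inv_inv (g : Arrows C) : g.inv.inv = g := by
  obtain ⟨a, b, g⟩ := g; simp [inv]

@[simp] theorem inv_unit (e : C) : (unit e).inv = unit e := by simp [inv, unit]

theorem comp_mk {a b c : C} (g : b ⟶ c) (h : a ⟶ b)
    (p : b = b) :
    comp ⟨b, c, g⟩ ⟨a, b, h⟩ p = ⟨a, c, h ≫ g⟩ := by
  have : h ≫ eqToHom p.symm ≫ g = h ≫ g := congrArg (h ≫ ·) (Category.id_comp g)
  simp only [comp, this]

theorem comp_congr {g g' h h' : Arrows C} (hg : g = g') (hh : h = h') (p : g.source = h.range)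
    (p' : g'.source = h'.range) : comp g h p = comp g' h' p' := by
  subst hg hh; rfl

theorem inv_comp_self (g : Arrows C) : comp g.inv g rfl = unit g.left := by
  obtain ⟨a, b, g⟩ := g; simp [comp_mk, inv, unit]

theorem comp_inv_self (g : Arrows C) : comp g g.inv rfl = unit g.right := by
  obtain ⟨a, b, g⟩ := g; simp [comp_mk, inv, unit]

theorem inv_comp (g h : Arrows C) (p : g.source = h.range) :
    (comp g h p).inv = comp h.inv g.inv p.symm := by
  obtain ⟨a, b, g⟩ := g
  obtain ⟨c, d, h⟩ := h
  obtain rfl : a = d := p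
  refine (congrArg inv (comp_mk g h rfl)).trans ?_
  refine Eq.trans ?_ (comp_mk (Groupoid.inv h) (Groupoid.inv g) rfl).symm
  simp [inv]

theorem comp_assoc (g h k : Arrows C) (p : g.source = h.range) (q : h.source = k.range) :
    comp (comp g h p) k q = comp g (comp h k q) p := by
  obtain ⟨a, b, g⟩ := g
  obtain ⟨c, d, h⟩ := h
  obtain ⟨c', d', k⟩ := k
  obtain rfl : a = d := p
  obtain rfl : c = d' := q
  refine (comp_congr (comp_mk g h rfl) rfl _ rfl).trans ?_
  refine Eq.trans ?_ (comp_congr rfl (comp_mk h k rfl) _ rfl).symm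
  rw [comp_mk, comp_mk, Category.assoc]

theorem comp_unit (g : Arrows C) (e : C) (p : g.source = e) : comp g (unit e) p = g := by
  obtain ⟨a, b, g⟩ := g
  obtain rfl : a = e := p
  simp [comp_mk, unit]

theorem unit_comp (g : Arrows C) (e : C) (p : e = g.range) : comp (unit e) g p = g := by
  obtain ⟨a, b, g⟩ := g
  obtain rfl : e = b := p
  simp [comp_mk, unit]

theorem comp_inv_comp (g h : Arrows C) (p : g.source = h.source) :
    comp (comp g h.inv p) h rfl = g := by
  rw [comp_assoc g h.inv h p rfl]
  have := inv_comp_self h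
  simp only [this]
  exact comp_unit _ _ p

theorem comp_comp_inv (g h : Arrows C) (p : g.source = h.range) :
    comp (comp g h p) h.inv rfl = g := by
  rw [comp_assoc g h h.inv p rfl]
  have := comp_inv_self h
  simp only [this]
  exact comp_unit _ _ p

theorem comp_inv_comp_inv (g h k : Arrows C) (p : g.source = k.source) (q : h.source = k.source) :
    comp (comp g k.inv p) (comp h k.inv q).inv rfl = comp g h.inv (p.trans q.symm) := by
  refine (comp_congr (g := comp g k.inv p) (g' := comp g k.inv p) rfl (inv_comp h k.inv q) rfl
    rfl).trans ?_
  refine (comp_assoc (comp g k.inv p) k.inv.inv h.inv rfl q.symm).symm.trans ?_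
  exact comp_congr (comp_comp_inv g k.inv p) rfl _ _

end Arrows

/-! ### Partial actions of groupoids on sets and on topological spaces -/

/-- A partial action of the groupoid `C` on the set `X`. The bijection `α_g : X_{g⁻¹} → X_g` is
the partial equivalence `map g`, whose source is `X_{g⁻¹}` and whose target is `X_g`; its values
outside of its source are irrelevant. -/
structure PartialAction (C : Type*) [Groupoid C] (X : Type*) where
  map : Arrows C → PartialEquiv X X
  source_map : ∀ g, (map g).source = (map g.inv).target
  target_subset : ∀ g, (map g).target ⊆ (map (Arrows.unit g.range)).target
  map_unit : ∀ e : C, ∀ x ∈ (map (Arrows.unit e)).target, map (Arrows.unit e) x = x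
  symm_image_subset : ∀ (g h : Arrows C) (p : g.source = h.range),
    (map h).symm '' ((map g.inv).target ∩ (map h).target) ⊆ (map (Arrows.comp g h p).inv).target
  map_map : ∀ (g h : Arrows C) (p : g.source = h.range),
    ∀ x ∈ (map h).symm '' ((map g.inv).target ∩ (map h).target),
      map g (map h x) = map (Arrows.comp g h p) x

namespace PartialAction

variable {C : Type*} [Groupoid C] {X : Type*} (θ : PartialAction C X)

/-- The set `X_g`. -/
def carrier (g : Arrows C) : Set X := (θ.map g).target

theorem source_eq (g : Arrows C) : (θ.map g).source = θ.carrier g.inv := θ.source_map g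

theorem map_mem {g : Arrows C} {x : X} (hx : x ∈ θ.carrier g.inv) : θ.map g x ∈ θ.carrier g :=
  (θ.map g).map_source (by rwa [source_eq])

theorem mem_unit {g : Arrows C} {x : X} (hx : x ∈ θ.carrier g) :
    x ∈ θ.carrier (Arrows.unit g.right) := θ.target_subset g hx

theorem mem_symm_image {g h : Arrows C} {x : X} (hx : x ∈ θ.carrier h.inv)
    (hx' : θ.map h x ∈ θ.carrier g.inv) :
    x ∈ (θ.map h).symm '' ((θ.map g.inv).target ∩ (θ.map h).target) :=
  ⟨θ.map h x, ⟨hx', θ.map_mem hx⟩, (θ.map h).left_inv (by rwa [source_eq])⟩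

theorem mem_comp_inv {g h : Arrows C} (p : g.source = h.range) {x : X}
    (hx : x ∈ θ.carrier h.inv) (hx' : θ.map h x ∈ θ.carrier g.inv) :
    x ∈ θ.carrier (Arrows.comp g h p).inv :=
  θ.symm_image_subset g h p (θ.mem_symm_image hx hx')

theorem map_comp {g h : Arrows C} (p : g.source = h.range) {x : X}
    (hx : x ∈ θ.carrier h.inv) (hx' : θ.map h x ∈ θ.carrier g.inv) :
    θ.map (Arrows.comp g h p) x = θ.map g (θ.map h x) :=
  (θ.map_map g h p x (θ.mem_symm_image hx hx')).symm

theorem map_inv_map {g : Arrows C} {x : X} (hx : x ∈ θ.carrier g.inv) :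
    θ.map g.inv (θ.map g x) = x := by
  have h1 : θ.map g x ∈ θ.carrier g.inv.inv := by simpa using θ.map_mem hx
  rw [← θ.map_comp (g := g.inv) (h := g) rfl hx h1, Arrows.inv_comp_self]
  exact θ.map_unit _ _ (θ.mem_unit hx)

theorem map_map_inv {g : Arrows C} {x : X} (hx : x ∈ θ.carrier g) :
    θ.map g (θ.map g.inv x) = x := by
  have := θ.map_inv_map (g := g.inv) (x := x) (by simpa using hx)
  simpa using this

theorem map_inv_mem {g : Arrows C} {x : X} (hx : x ∈ θ.carrier g) :
    θ.map g.inv x ∈ θ.carrier g.inv := θ.map_mem (by simpa using hx)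

theorem map_mem_comp {g h : Arrows C} (p : g.source = h.range) {x : X}
    (hx : x ∈ θ.carrier g.inv) (hx' : x ∈ θ.carrier h) :
    θ.map g x ∈ θ.carrier (Arrows.comp g h p) := by
  have := θ.mem_comp_inv (g := h.inv) (h := g.inv) p.symm (x := θ.map g x)
    (by simpa using θ.map_mem hx) (by simpa [θ.map_inv_map hx] using hx')
  rwa [← Arrows.inv_comp g h p, Arrows.inv_inv] at this

end PartialAction

/-- A topological partial action: every `X_g` is open and every `θ_g : X_{g⁻¹} → X_g` is a
homeomorphism. -/
structure TopologicalPartialAction (C : Type*) [Groupoid C] (X : Type*) [TopologicalSpace X]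
    extends PartialAction C X where
  isOpen_carrier : ∀ g, IsOpen (toPartialAction.carrier g)
  continuousOn_map : ∀ g, ContinuousOn (map g) (map g).source
  continuousOn_symm : ∀ g, ContinuousOn (map g).symm (map g).target

/-! ### Partial actions on algebras and partial skew groupoid rings -/

/-- A partial action of the groupoid `C` on the (not necessarily unital) `R`-algebra `A`: a partial
action on the set `A` such that `D_e` is an ideal of `A` for all objects `e`, `D_g` is an ideal of
`D_{r(g)}`, and `α_g : D_{g⁻¹} → D_g` is an isomorphism, for all `g`. For `R = ℤ` this is a partial
action on the ring `A`. -/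
structure AlgebraPartialAction (R : Type*) [CommRing R] (C : Type*) [Groupoid C]
    (A : Type*) [NonUnitalRing A] [Module R A] extends PartialAction C A where
  /-- The set `D_g` with its structure of a submodule. -/
  D : Arrows C → Submodule R A
  coe_D : ∀ g, (D g : Set A) = toPartialAction.carrier g
  ideal_unit : ∀ (e : C) (a d : A), d ∈ D (Arrows.unit e) →
    a * d ∈ D (Arrows.unit e) ∧ d * a ∈ D (Arrows.unit e)
  ideal : ∀ (g : Arrows C) (a d : A), a ∈ D (Arrows.unit g.range) → d ∈ D g →
    a * d ∈ D g ∧ d * a ∈ D g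
  map_add : ∀ (g : Arrows C), ∀ a ∈ D g.inv, ∀ b ∈ D g.inv, map g (a + b) = map g a + map g b
  map_mul : ∀ (g : Arrows C), ∀ a ∈ D g.inv, ∀ b ∈ D g.inv, map g (a * b) = map g a * map g b
  map_smul : ∀ (g : Arrows C) (c : R), ∀ a ∈ D g.inv, map g (c • a) = c • map g a

namespace AlgebraPartialAction

variable {R : Type*} [CommRing R] {C : Type*} [Groupoid C] {A : Type*} [NonUnitalRing A]
  [Module R A] (α : AlgebraPartialAction R C A)

theorem mem_D {g : Arrows C} {a : A} : a ∈ α.D g ↔ a ∈ α.carrier g := by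
  rw [← α.coe_D]; rfl

theorem map_inv_mul_mem {g h : Arrows C} (p : g.source = h.range) {a b : A} (ha : a ∈ α.D g)
    (hb : b ∈ α.D h) : α.map g.inv a * b ∈ α.D g.inv ∧ α.map g.inv a * b ∈ α.D h := by
  have h1 : α.map g.inv a ∈ α.D g.inv := α.mem_D.2 (α.map_inv_mem (α.mem_D.1 ha))
  have h2 : α.map g.inv a ∈ α.D (Arrows.unit g.left) := α.mem_D.2 (α.mem_unit (α.mem_D.1 h1))
  have h3 : b ∈ α.D (Arrows.unit h.right) := α.mem_D.2 (α.mem_unit (α.mem_D.1 hb))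
  refine ⟨(α.ideal g.inv b _ ?_ h1).2, (α.ideal h _ b ?_ hb).1⟩
  · change b ∈ α.D (Arrows.unit g.left)
    rwa [show g.left = h.right from p]
  · change _ ∈ α.D (Arrows.unit h.right)
    rwa [← show g.left = h.right from p]

theorem map_map_inv_mul_mem {g h : Arrows C} (p : g.source = h.range) {a b : A}
    (ha : a ∈ α.D g) (hb : b ∈ α.D h) :
    α.map g (α.map g.inv a * b) ∈ α.D (Arrows.comp g h p) :=
  α.mem_D.2 (α.map_mem_comp p (α.mem_D.1 (α.map_inv_mul_mem p ha hb).1)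
    (α.mem_D.1 (α.map_inv_mul_mem p ha hb).2))

/-- The partial skew groupoid ring `A ⋊_α C`: the set of all formal finite sums
`∑ a_g δ_g` with `a_g ∈ D_g`. -/
def SkewGroupoidRing : Type _ := DirectSum (Arrows C) (fun g => α.D g)

namespace SkewGroupoidRing

instance : AddCommGroup α.SkewGroupoidRing :=
  inferInstanceAs (AddCommGroup (DirectSum (Arrows C) (fun g => α.D g)))

instance : Module R α.SkewGroupoidRing :=
  inferInstanceAs (Module R (DirectSum (Arrows C) (fun g => α.D g)))

open Classical in
/-- The element `a δ_g`. -/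
def single (g : Arrows C) : α.D g →ₗ[R] α.SkewGroupoidRing :=
  DirectSum.lof R (Arrows C) (fun g => α.D g) g

open Classical in
/-- The linear map on formal sums with prescribed values on the homogeneous elements. -/
def lift {M : Type*} [AddCommGroup M] [Module R M] (f : ∀ g, α.D g →ₗ[R] M) :
    α.SkewGroupoidRing →ₗ[R] M :=
  DirectSum.toModule R (Arrows C) M f

theorem lift_single {M : Type*} [AddCommGroup M] [Module R M] (f : ∀ g, α.D g →ₗ[R] M)
    (g : Arrows C) (a : α.D g) : lift α f (single α g a) = f g a := by
  classical
  exact DirectSum.toModule_lof (M := fun g => α.D g) R g a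

variable [IsScalarTower R A A] [SMulCommClass R A A]

/-- `(a δ_g) (b δ_h) = α_g(α_{g⁻¹}(a) b) δ_{gh}` for a composable pair `(g, h)`. -/
def mulComposable (g h : Arrows C) (p : g.source = h.range) :
    α.D g →ₗ[R] α.D h →ₗ[R] α.SkewGroupoidRing :=
  LinearMap.mk₂ R
    (fun a b => single α (Arrows.comp g h p)
      ⟨α.map g (α.map g.inv a * b), α.map_map_inv_mul_mem p a.2 b.2⟩)
    (by
      intro a a' b
      rw [← _root_.map_add]
      congr 1
      apply Subtype.ext
      simp only [Submodule.coe_add]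
      rw [α.map_add g.inv _ (by simp) _ (by simp), add_mul, α.map_add g _
        (α.map_inv_mul_mem p a.2 b.2).1 _ (α.map_inv_mul_mem p a'.2 b.2).1])
    (by
      intro c a b
      rw [← _root_.map_smul]
      congr 1
      apply Subtype.ext
      simp only [Submodule.coe_smul]
      rw [α.map_smul g.inv c _ (by simp), smul_mul_assoc, α.map_smul g c _
        (α.map_inv_mul_mem p a.2 b.2).1])
    (by
      intro a b b'
      rw [← _root_.map_add]
      congr 1
      apply Subtype.ext
      simp only [Submodule.coe_add]
      rw [mul_add, α.map_add g _
        (α.map_inv_mul_mem p a.2 b.2).1 _ (α.map_inv_mul_mem p a.2 b'.2).1])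
    (by
      intro c a b
      rw [← _root_.map_smul]
      congr 1
      apply Subtype.ext
      simp only [Submodule.coe_smul]
      rw [mul_smul_comm, α.map_smul g c _ (α.map_inv_mul_mem p a.2 b.2).1])

open Classical in
/-- The product of `a δ_g` and `b δ_h`, which is zero if `(g, h)` is not composable. -/
def mulSingle (g h : Arrows C) : α.D g →ₗ[R] α.D h →ₗ[R] α.SkewGroupoidRing :=
  if p : g.source = h.range then mulComposable α g h p else 0

/-- The bilinear extension of the product of homogeneous elements. -/
def mulLinear : α.SkewGroupoidRing →ₗ[R] α.SkewGroupoidRing →ₗ[R] α.SkewGroupoidRing :=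
  lift α fun g => (lift α fun h => (mulSingle α g h).flip).flip

instance : Mul α.SkewGroupoidRing := ⟨fun x y => mulLinear α x y⟩

theorem mul_def (x y : α.SkewGroupoidRing) : x * y = mulLinear α x y := rfl

theorem single_mul_single (g h : Arrows C) (a : α.D g) (b : α.D h) :
    single α g a * single α h b = mulSingle α g h a b := by
  rw [mul_def, mulLinear, lift_single, LinearMap.flip_apply, lift_single, LinearMap.flip_apply]

theorem single_mul_single_of_composable (g h : Arrows C) (p : g.source = h.range) (a : α.D g)
    (b : α.D h) :
    single α g a * single α h b = single α (Arrows.comp g h p)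
      ⟨α.map g (α.map g.inv a * b), α.map_map_inv_mul_mem p a.2 b.2⟩ := by
  rw [single_mul_single, mulSingle, dif_pos p]
  rfl

theorem single_mul_single_of_not (g h : Arrows C) (p : ¬ g.source = h.range) (a : α.D g)
    (b : α.D h) : single α g a * single α h b = 0 := by
  rw [single_mul_single, mulSingle, dif_neg p]
  rfl

instance : NonUnitalNonAssocRing α.SkewGroupoidRing where
  left_distrib x y z := by simp only [mul_def, _root_.map_add]
  right_distrib x y z := by simp only [mul_def, _root_.map_add, LinearMap.add_apply]
  zero_mul x := by simp only [mul_def, _root_.map_zero, LinearMap.zero_apply]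
  mul_zero x := by simp only [mul_def, _root_.map_zero]

instance : IsScalarTower R α.SkewGroupoidRing α.SkewGroupoidRing where
  smul_assoc c x y := by simp only [smul_eq_mul, mul_def, _root_.map_smul, LinearMap.smul_apply]

instance : SMulCommClass R α.SkewGroupoidRing α.SkewGroupoidRing where
  smul_comm c x y := by simp only [smul_eq_mul, mul_def, _root_.map_smul]

end SkewGroupoidRing

end AlgebraPartialAction

/-! ### Locally constant functions with compact support -/

/-- The `R`-algebra of locally constant functions `X → R` with compact support
`{x | f x ≠ 0}`, with pointwise operations. -/
def locConst (X : Type*) [TopologicalSpace X] (R : Type*) [CommRing R] :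
    NonUnitalSubalgebra R (X → R) where
  carrier := {f | IsLocallyConstant f ∧ IsCompact (Function.support f)}
  zero_mem' := ⟨IsLocallyConstant.const 0, by simp⟩
  add_mem' {f g} hf hg := by
    refine ⟨hf.1.add hg.1, (hf.2.union hg.2).of_isClosed_subset ?_ (Function.support_add f g)⟩
    exact ((hf.1.add hg.1).isOpen_fiber 0).isClosed_compl
  mul_mem' {f g} hf hg := by
    refine ⟨hf.1.mul hg.1, hf.2.of_isClosed_subset ?_ (Function.support_mul_subset_left f g)⟩
    exact ((hf.1.mul hg.1).isOpen_fiber 0).isClosed_compl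
  smul_mem' c f hf := by
    have h : IsLocallyConstant (c • f) := hf.1.comp (fun r => c • r)
    exact ⟨h, hf.2.of_isClosed_subset (h.isOpen_fiber 0).isClosed_compl
      (Function.support_const_smul_subset c f)⟩

namespace TopologicalPartialAction

variable {C : Type*} [Groupoid C] {X : Type*} [TopologicalSpace X]
  (θ : TopologicalPartialAction C X)

theorem continuousOn_carrier (g : Arrows C) : ContinuousOn (θ.map g) (θ.carrier g.inv) := by
  rw [← θ.source_eq]; exact θ.continuousOn_map g


variable (R : Type*) [CommRing R]

open Classical in
/-- The function `x ↦ f (θ_{g⁻¹} x)` on `X_g`, extended by zero. -/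
def inducedFun (g : Arrows C) (f : X → R) : X → R :=
  fun x => if x ∈ θ.carrier g then f (θ.map g.inv x) else 0

variable {R}

theorem inducedFun_apply_of_mem {g : Arrows C} (f : X → R) {x : X} (hx : x ∈ θ.carrier g) :
    θ.inducedFun R g f x = f (θ.map g.inv x) := if_pos hx

theorem inducedFun_apply_of_not_mem {g : Arrows C} (f : X → R) {x : X} (hx : x ∉ θ.carrier g) :
    θ.inducedFun R g f x = 0 := if_neg hx

theorem inducedFun_map {g : Arrows C} (f : X → R) {x : X} (hx : x ∈ θ.carrier g.inv) :
    θ.inducedFun R g f (θ.map g x) = f x := by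
  rw [inducedFun_apply_of_mem _ _ (θ.map_mem hx), θ.map_inv_map hx]

theorem support_inducedFun_subset (g : Arrows C) (f : X → R) :
    Function.support (θ.inducedFun R g f) ⊆ θ.carrier g := by
  intro x hx
  by_contra h
  exact hx (inducedFun_apply_of_not_mem θ f h)

theorem support_inducedFun {g : Arrows C} {f : X → R}
    (hf : Function.support f ⊆ θ.carrier g.inv) :
    Function.support (θ.inducedFun R g f) = θ.map g '' Function.support f := by
  ext x
  constructor
  · intro hx
    have hxg := θ.support_inducedFun_subset g f hx
    refine ⟨θ.map g.inv x, ?_, θ.map_map_inv hxg⟩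
    rwa [Function.mem_support, inducedFun_apply_of_mem θ f hxg] at hx
  · rintro ⟨y, hy, rfl⟩
    rwa [Function.mem_support, inducedFun_map θ f (hf hy)]

theorem inducedFun_mem [T2Space X] {g : Arrows C} {f : X → R} (hf : f ∈ locConst X R)
    (hs : Function.support f ⊆ θ.carrier g.inv) : θ.inducedFun R g f ∈ locConst X R := by
  have hc : IsCompact (Function.support (θ.inducedFun R g f)) := by
    rw [support_inducedFun θ hs]
    exact hf.2.image_of_continuousOn ((θ.continuousOn_carrier g).mono hs)
  refine ⟨(IsLocallyConstant.iff_eventually_eq _).2 fun x => ?_, hc⟩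
  by_cases hx : x ∈ θ.carrier g
  · have hn : θ.carrier g ∈ 𝓝 x := (θ.isOpen_carrier g).mem_nhds hx
    have h1 : ContinuousOn (θ.map g.inv) (θ.carrier g) := by
      simpa using θ.continuousOn_carrier g.inv
    have h2 := (h1.continuousAt hn).eventually (hf.1.eventually_eq (θ.map g.inv x))
    filter_upwards [h2, hn] with y hy hyg
    rw [inducedFun_apply_of_mem θ f hx, inducedFun_apply_of_mem θ f hyg, hy]
  · have hx0 : x ∉ Function.support (θ.inducedFun R g f) :=
      fun h => hx (θ.support_inducedFun_subset g f h)
    filter_upwards [hc.isClosed.isOpen_compl.mem_nhds hx0] with y hy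
    rw [Function.notMem_support.1 hx0, Function.notMem_support.1 hy]

theorem inducedFun_inducedFun {g : Arrows C} {f : X → R}
    (hs : Function.support f ⊆ θ.carrier g.inv) :
    θ.inducedFun R g.inv (θ.inducedFun R g f) = f := by
  ext x
  by_cases hx : x ∈ θ.carrier g.inv
  · rw [inducedFun_apply_of_mem θ _ hx, Arrows.inv_inv, inducedFun_map θ f hx]
  · rw [inducedFun_apply_of_not_mem θ _ hx, Function.notMem_support.1 (fun h => hx (hs h))]

variable (R)

/-- The ideal `D_g` of all functions with support in `X_g`. -/
def inducedIdeal (g : Arrows C) : Submodule R (locConst X R) where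
  carrier := {f | Function.support (f : X → R) ⊆ θ.carrier g}
  zero_mem' := by simp
  add_mem' {f f'} hf hf' := (Function.support_add _ _).trans (Set.union_subset hf hf')
  smul_mem' c f hf := (Function.support_const_smul_subset c _).trans hf

variable {R}

theorem mem_inducedIdeal {g : Arrows C} {f : locConst X R} :
    f ∈ θ.inducedIdeal R g ↔ Function.support (f : X → R) ⊆ θ.carrier g := Iff.rfl

variable [T2Space X]

variable (R) in
open Classical in
/-- The map `α_g : D_{g⁻¹} → D_g`, with the value zero outside of `D_{g⁻¹}`. -/
def inducedMap (g : Arrows C) (f : locConst X R) : locConst X R :=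
  if h : f ∈ θ.inducedIdeal R g.inv then ⟨θ.inducedFun R g f, θ.inducedFun_mem f.2 h⟩ else 0

theorem coe_inducedMap {g : Arrows C} {f : locConst X R} (h : f ∈ θ.inducedIdeal R g.inv) :
    (θ.inducedMap R g f : X → R) = θ.inducedFun R g f := by
  rw [inducedMap, dif_pos h]

theorem inducedMap_mem {g : Arrows C} {f : locConst X R} (h : f ∈ θ.inducedIdeal R g.inv) :
    θ.inducedMap R g f ∈ θ.inducedIdeal R g := by
  rw [mem_inducedIdeal, coe_inducedMap θ h]
  exact θ.support_inducedFun_subset g (f : X → R)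

theorem inducedMap_inducedMap {g : Arrows C} {f : locConst X R}
    (h : f ∈ θ.inducedIdeal R g.inv) : θ.inducedMap R g.inv (θ.inducedMap R g f) = f := by
  apply Subtype.ext
  rw [coe_inducedMap θ (by simpa using θ.inducedMap_mem h), coe_inducedMap θ h,
    inducedFun_inducedFun θ h]

variable (R) in
/-- The bijection `α_g : D_{g⁻¹} → D_g`. -/
def inducedEquiv (g : Arrows C) : PartialEquiv (locConst X R) (locConst X R) where
  toFun := θ.inducedMap R g
  invFun := θ.inducedMap R g.inv
  source := θ.inducedIdeal R g.inv
  target := θ.inducedIdeal R g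
  map_source' _ h := θ.inducedMap_mem h
  map_target' _ h := θ.inducedMap_mem (by simpa using h)
  left_inv' _ h := θ.inducedMap_inducedMap h
  right_inv' f h := by
    have := θ.inducedMap_inducedMap (g := g.inv) (f := f) (by simpa using h)
    simpa using this

theorem inducedEquiv_comp_aux {g h : Arrows C} (p : g.source = h.range) {f : locConst X R}
    (hf : f ∈ (θ.inducedEquiv R h).symm ''
      ((θ.inducedEquiv R g.inv).target ∩ (θ.inducedEquiv R h).target)) :
    f ∈ θ.inducedIdeal R h.inv ∧ θ.inducedMap R h f ∈ θ.inducedIdeal R g.inv ∧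
      f ∈ θ.inducedIdeal R (Arrows.comp g h p).inv := by
  obtain ⟨k, ⟨hk1, hk2⟩, rfl⟩ := hf
  have hk : (θ.inducedEquiv R h).symm k ∈ θ.inducedIdeal R h.inv :=
    (θ.inducedEquiv R h).map_target hk2
  have hk' : θ.inducedMap R h ((θ.inducedEquiv R h).symm k) = k :=
    (θ.inducedEquiv R h).right_inv hk2
  refine ⟨hk, by rw [hk']; exact hk1, ?_⟩
  intro x hx
  have hxh : x ∈ θ.carrier h.inv := hk hx
  refine θ.mem_comp_inv p hxh (hk1 ?_)
  rw [← hk', Function.mem_support, coe_inducedMap θ hk, inducedFun_map θ _ hxh]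
  exact hx

variable (R) in
/-- The partial action of the groupoid on `L_c(X, R)` induced by a topological partial action. -/
def induced : AlgebraPartialAction R C (locConst X R) where
  map := θ.inducedEquiv R
  source_map _ := rfl
  target_subset g _ hf := hf.trans (θ.target_subset g)
  map_unit e f hf := by
    replace hf : f ∈ θ.inducedIdeal R (Arrows.unit e) := hf
    have hf' : f ∈ θ.inducedIdeal R (Arrows.unit e).inv := by simpa using hf
    apply Subtype.ext
    refine (coe_inducedMap θ hf').trans ?_
    ext x
    by_cases hx : x ∈ θ.carrier (Arrows.unit e)
    · rw [inducedFun_apply_of_mem θ _ hx, Arrows.inv_unit, θ.map_unit e x hx]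
    · rw [inducedFun_apply_of_not_mem θ _ hx, Function.notMem_support.1 (fun h => hx (hf h))]
  symm_image_subset g h p _ hf := (θ.inducedEquiv_comp_aux p hf).2.2
  map_map g h p f hf := by
    obtain ⟨h1, h2, h3⟩ := θ.inducedEquiv_comp_aux p hf
    apply Subtype.ext
    refine (coe_inducedMap θ h2).trans (Eq.trans ?_ (coe_inducedMap θ h3).symm)
    rw [coe_inducedMap θ h1]
    ext x
    by_cases hx : x ∈ Function.support (θ.inducedFun R g (θ.inducedFun R h f)) ∪
        Function.support (θ.inducedFun R (Arrows.comp g h p) f)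
    · obtain ⟨y, hy1, hy2, rfl⟩ : ∃ y, y ∈ θ.carrier h.inv ∧ θ.map h y ∈ θ.carrier g.inv ∧
          θ.map g (θ.map h y) = x := by
        rw [mem_inducedIdeal, coe_inducedMap θ h1] at h2
        rcases hx with hx | hx
        · rw [support_inducedFun θ h2, support_inducedFun θ h1] at hx
          obtain ⟨_, ⟨y, hy, rfl⟩, rfl⟩ := hx
          refine ⟨y, h1 hy, h2 ?_, rfl⟩
          rw [support_inducedFun θ h1]
          exact ⟨y, hy, rfl⟩
        · rw [support_inducedFun θ h3] at hx
          obtain ⟨y, hy, rfl⟩ := hx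
          have hy' : θ.map h y ∈ θ.carrier g.inv := by
            apply h2
            rw [support_inducedFun θ h1]
            exact ⟨y, hy, rfl⟩
          exact ⟨y, h1 hy, hy', (θ.map_comp p (h1 hy) hy').symm⟩
      rw [inducedFun_map θ _ hy2, inducedFun_map θ _ hy1, ← θ.map_comp p hy1 hy2,
        inducedFun_map θ _ (θ.mem_comp_inv p hy1 hy2)]
    · rw [Set.mem_union, not_or] at hx
      rw [Function.notMem_support.1 hx.1, Function.notMem_support.1 hx.2]
  D := θ.inducedIdeal R
  coe_D _ := rfl
  ideal_unit e a d hd :=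
    ⟨(Function.support_mul_subset_right _ _).trans hd,
      (Function.support_mul_subset_left _ _).trans hd⟩
  ideal g a d _ hd :=
    ⟨(Function.support_mul_subset_right _ _).trans hd,
      (Function.support_mul_subset_left _ _).trans hd⟩
  map_add g a ha b hb := by
    apply Subtype.ext
    change (θ.inducedMap R g (a + b) : X → R) = θ.inducedMap R g a + θ.inducedMap R g b
    rw [coe_inducedMap θ ha, coe_inducedMap θ hb, coe_inducedMap θ (add_mem ha hb)]
    ext x
    by_cases hx : x ∈ θ.carrier g <;> simp [inducedFun, hx]
  map_mul g a ha b hb := by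
    have hab : a * b ∈ θ.inducedIdeal R g.inv :=
      (Function.support_mul_subset_right _ _).trans hb
    apply Subtype.ext
    change (θ.inducedMap R g (a * b) : X → R) = θ.inducedMap R g a * θ.inducedMap R g b
    rw [coe_inducedMap θ ha, coe_inducedMap θ hb, coe_inducedMap θ hab]
    ext x
    by_cases hx : x ∈ θ.carrier g <;> simp [inducedFun, hx]
  map_smul g c a ha := by
    apply Subtype.ext
    change (θ.inducedMap R g (c • a) : X → R) = c • (θ.inducedMap R g a : X → R)
    rw [coe_inducedMap θ ha, coe_inducedMap θ (Submodule.smul_mem _ c ha)]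
    ext x
    by_cases hx : x ∈ θ.carrier g <;> simp [inducedFun, hx]

end TopologicalPartialAction

/-! ### Étale groupoids and Steinberg algebras -/

/-- Hausdorff étale groupoids: the set of objects and the set of morphisms carry topologies for which
all structure maps are continuous, the source map is a local homeomorphism, and the space of
morphisms is Hausdorff. -/
class HausdorffEtaleGroupoid (𝒢 : Type*) [Groupoid 𝒢] [TopologicalSpace 𝒢]
    [TopologicalSpace (Arrows 𝒢)] : Prop where
  t2 : T2Space (Arrows 𝒢)
  continuous_range : Continuous (Arrows.range : Arrows 𝒢 → 𝒢)
  continuous_unit : Continuous (Arrows.unit : 𝒢 → Arrows 𝒢)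
  continuous_inv : Continuous (Arrows.inv : Arrows 𝒢 → Arrows 𝒢)
  continuous_comp : Continuous
    (fun p : {p : Arrows 𝒢 × Arrows 𝒢 // p.1.source = p.2.range} =>
      Arrows.comp p.1.1 p.1.2 p.2)
  isLocalHomeomorph_source : IsLocalHomeomorph (Arrows.source : Arrows 𝒢 → 𝒢)

section Convolution

variable {𝒢 : Type*} [Groupoid 𝒢] {R : Type*} [CommRing R]

/-- The convolution product `(f * g)(γ) = ∑ f(γ β⁻¹) g(β)`, where the sum is over all `β` with the
same source as `γ`; equivalently, it is the sum of all `f(α) g(β)` with `α β = γ`. -/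
def convolution (f g : Arrows 𝒢 → R) (γ : Arrows 𝒢) : R :=
  ∑ᶠ β : {β : Arrows 𝒢 // β.source = γ.source}, f (Arrows.comp γ β.1.inv β.2.symm) * g β.1

variable [TopologicalSpace 𝒢] [TopologicalSpace (Arrows 𝒢)] [HausdorffEtaleGroupoid 𝒢]

open HausdorffEtaleGroupoid

variable (𝒢) in
theorem t2Space_objects : T2Space 𝒢 := by
  have := HausdorffEtaleGroupoid.t2 (𝒢 := 𝒢)
  refine T2Space.of_injective_continuous (f := Arrows.unit (C := 𝒢)) ?_ continuous_unit
  intro a b h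
  exact congrArg Quiver.Total.left h

theorem finite_fiber {K : Set (Arrows 𝒢)} (hK : IsCompact K) (x : 𝒢) :
    {β : Arrows 𝒢 | β ∈ K ∧ β.source = x}.Finite := by
  have h := isLocalHomeomorph_source (𝒢 := 𝒢)
  choose e he he' using h
  obtain ⟨t, -, ht⟩ := hK.elim_nhds_subcover (fun β => (e β).source)
    (fun β _ => (e β).open_source.mem_nhds (he β))
  refine (Set.Finite.biUnion t.finite_toSet
    (t := fun b => {β | β ∈ (e b).source ∧ β.source = x}) (fun b _ => ?_)).subset ?_
  · apply Set.Subsingleton.finite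
    intro β hβ β' hβ'
    apply (e b).injOn hβ.1 hβ'.1
    rw [← he' b]
    exact hβ.2.trans hβ'.2.symm
  · rintro β ⟨hβ, hx⟩
    obtain ⟨b, hb, hb'⟩ := Set.mem_iUnion₂.1 (ht hβ)
    exact Set.mem_iUnion₂.2 ⟨b, hb, hb', hx⟩

theorem finite_support_convolution (f : Arrows 𝒢 → R) {g : Arrows 𝒢 → R}
    (hg : IsCompact (Function.support g)) (γ : Arrows 𝒢) :
    (Function.support (fun β : {β : Arrows 𝒢 // β.source = γ.source} =>
      f (Arrows.comp γ β.1.inv β.2.symm) * g β.1)).Finite := by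
  have h := (finite_fiber hg γ.source).preimage
    (f := (Subtype.val : {β : Arrows 𝒢 // β.source = γ.source} → Arrows 𝒢))
    Subtype.val_injective.injOn
  refine h.subset fun β hβ => ⟨?_, β.2⟩
  exact fun h0 => hβ (by simp [h0])

theorem eventually_comp_inv {S : Type*} {f : Arrows 𝒢 → S} (hf : IsLocallyConstant f) (γ β : Arrows 𝒢)
    (p : γ.source = β.source) :
    ∀ᶠ q : Arrows 𝒢 × Arrows 𝒢 in 𝓝 (γ, β), ∀ h : q.1.source = q.2.source,
      f (Arrows.comp q.1 q.2.inv h) = f (Arrows.comp γ β.inv p) := by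
  have hc : Continuous (fun q : {q : Arrows 𝒢 × Arrows 𝒢 // q.1.source = q.2.source} =>
      Arrows.comp q.1.1 q.1.2.inv q.2) := by
    refine (continuous_comp (𝒢 := 𝒢)).comp (Continuous.subtype_mk (f := fun q :
      {q : Arrows 𝒢 × Arrows 𝒢 // q.1.source = q.2.source} => (q.1.1, q.1.2.inv)) ?_ fun q => q.2)
    exact (continuous_fst.comp continuous_subtype_val).prodMk
      (continuous_inv.comp (continuous_snd.comp continuous_subtype_val))
  have h1 := (hf.comp_continuous hc).eventually_eq ⟨(γ, β), p⟩
  rw [nhds_subtype_eq_comap, Filter.eventually_comap] at h1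
  filter_upwards [h1] with q hq h
  exact hq ⟨q, h⟩ rfl

theorem isLocallyConstant_convolution {f g : Arrows 𝒢 → R} (hf : f ∈ locConst (Arrows 𝒢) R)
    (hg : g ∈ locConst (Arrows 𝒢) R) : IsLocallyConstant (convolution f g) := by
  have := t2Space_objects 𝒢
  have := HausdorffEtaleGroupoid.t2 (𝒢 := 𝒢)
  have hs := isLocalHomeomorph_source (𝒢 := 𝒢)
  refine (IsLocallyConstant.iff_eventually_eq _).2 fun γ₀ => ?_
  set F : Set (Arrows 𝒢) := {β | β ∈ Function.support g ∧ β.source = γ₀.source} with hF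
  have hfin : F.Finite := finite_fiber hg.2 γ₀.source
  have : Finite F := hfin
  obtain ⟨V, hV, hVd⟩ := hfin.t2_separation
  choose e he he' using hs
  have he'' : ∀ b β : Arrows 𝒢, e b β = β.source := fun b β => (congrFun (he' b) β).symm
  let W : Arrows 𝒢 → Set (Arrows 𝒢) := fun b => V b ∩ (e b).source ∩ {β | g β = g b}
  have hW : ∀ b, IsOpen (W b) := fun b =>
    ((hV b).2.inter (e b).open_source).inter (hg.1.isOpen_fiber _)
  have hbW : ∀ b, b ∈ W b := fun b => ⟨⟨(hV b).1, he b⟩, rfl⟩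
  let Z : Set 𝒢 := Arrows.source '' (Function.support g \ ⋃ b ∈ F, W b)
  have hZ : IsClosed Z :=
    ((hg.2.diff (isOpen_biUnion fun b _ => hW b)).image
      (isLocalHomeomorph_source (𝒢 := 𝒢)).continuous).isClosed
  have hxZ : γ₀.source ∉ Z := by
    rintro ⟨β, ⟨hβ, hβ'⟩, hx⟩
    exact hβ' (Set.mem_iUnion₂.2 ⟨β, ⟨hβ, hx⟩, hbW β⟩)
  have hsrc : Filter.Tendsto (Arrows.source : Arrows 𝒢 → 𝒢) (𝓝 γ₀) (𝓝 γ₀.source) :=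
    (isLocalHomeomorph_source (𝒢 := 𝒢)).continuous.continuousAt
  have hsec : ∀ b : F, Filter.Tendsto (fun γ : Arrows 𝒢 => (e b).symm γ.source) (𝓝 γ₀)
      (𝓝 b.1) := by
    intro b
    have h1 := (e b.1).tendsto_symm (he b.1)
    rw [he'', b.2.2] at h1
    exact h1.comp hsrc
  have key : ∀ᶠ γ in 𝓝 γ₀, convolution f g γ =
      ∑ᶠ b : F, f (Arrows.comp γ₀ b.1.inv b.2.2.symm) * g b.1 := by
    have h1 : ∀ᶠ γ in 𝓝 γ₀, ∀ b : F, γ.source ∈ (e b.1).target := by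
      refine Filter.eventually_all.2 fun b => hsrc.eventually ?_
      refine (e b.1).open_target.mem_nhds ?_
      rw [← b.2.2, ← he'' b.1]
      exact (e b.1).map_source (he b.1)
    have h2 : ∀ᶠ γ in 𝓝 γ₀, ∀ b : F, (e b.1).symm γ.source ∈ W b.1 :=
      Filter.eventually_all.2 fun b => (hsec b).eventually ((hW b.1).mem_nhds (hbW b.1))
    have h3 : ∀ᶠ γ in 𝓝 γ₀, γ.source ∉ Z :=
      hsrc.eventually (hZ.isOpen_compl.mem_nhds hxZ)
    have h4 : ∀ᶠ γ in 𝓝 γ₀, ∀ b : F, ∀ h : γ.source = ((e b.1).symm γ.source).source,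
        f (Arrows.comp γ ((e b.1).symm γ.source).inv h) =
          f (Arrows.comp γ₀ b.1.inv b.2.2.symm) := by
      refine Filter.eventually_all.2 fun b => ?_
      exact (Filter.tendsto_id.prodMk_nhds (hsec b)).eventually
        (eventually_comp_inv hf.1 γ₀ b.1 b.2.2.symm)
    filter_upwards [h1, h2, h3, h4] with γ h1 h2 h3 h4
    have hsγ : ∀ b : F, ((e b.1).symm γ.source).source = γ.source := fun b => by
      rw [← he'' b.1]
      exact (e b.1).right_inv (h1 b)
    let s : F → {β : Arrows 𝒢 // β.source = γ.source} := fun b => ⟨(e b.1).symm γ.source, hsγ b⟩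
    have hinj : Function.Injective s := by
      intro b b' hbb
      by_contra hne
      have hd := hVd b.2 b'.2 (fun h => hne (Subtype.ext h))
      have hbb' : (e b.1).symm γ.source = (e b'.1).symm γ.source := congrArg Subtype.val hbb
      refine Set.disjoint_left.1 hd (h2 b).1.1 ?_
      rw [hbb']
      exact (h2 b').1.1
    have hsupp : Function.support (fun β : {β : Arrows 𝒢 // β.source = γ.source} =>
        f (Arrows.comp γ β.1.inv β.2.symm) * g β.1) ⊆ Set.range s := by
      intro β hβ
      have hgβ : β.1 ∈ Function.support g := fun h0 => hβ (by simp [h0])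
      have hβW : β.1 ∈ ⋃ b ∈ F, W b := by
        by_contra hn
        exact h3 ⟨β.1, ⟨hgβ, hn⟩, β.2⟩
      obtain ⟨b, hb, hβb⟩ := Set.mem_iUnion₂.1 hβW
      refine ⟨⟨b, hb⟩, Subtype.ext ?_⟩
      change (e b).symm γ.source = β.1
      have h5 := (e b).left_inv hβb.1.2
      rwa [he'' b, β.2] at h5
    rw [convolution, ← finsum_mem_univ, finsum_mem_inter_support_eq _ _
      (Set.range s) (by rw [Set.univ_inter, Set.inter_eq_right.2 hsupp]),
      finsum_mem_range hinj]
    refine finsum_congr fun b => ?_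
    rw [h4 b (hsγ b).symm]
    congr 1
    exact (h2 b).2
  filter_upwards [key] with γ hγ
  rw [hγ, key.self_of_nhds]

theorem convolution_mem {f g : Arrows 𝒢 → R} (hf : f ∈ locConst (Arrows 𝒢) R)
    (hg : g ∈ locConst (Arrows 𝒢) R) : convolution f g ∈ locConst (Arrows 𝒢) R := by
  have := t2Space_objects 𝒢
  have hlc := isLocallyConstant_convolution hf hg
  refine ⟨hlc, ?_⟩
  have hcl : IsClosed {p : Arrows 𝒢 × Arrows 𝒢 | p.1.source = p.2.range} :=
    isClosed_eq ((isLocalHomeomorph_source (𝒢 := 𝒢)).continuous.comp continuous_fst)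
      (continuous_range.comp continuous_snd)
  have hK : IsCompact ((Subtype.val :
      {p : Arrows 𝒢 × Arrows 𝒢 // p.1.source = p.2.range} → _) ⁻¹'
        (Function.support f ×ˢ Function.support g)) :=
    hcl.isClosedEmbedding_subtypeVal.isCompact_preimage (hf.2.prod hg.2)
  refine (hK.image continuous_comp).of_isClosed_subset (hlc.isOpen_fiber 0).isClosed_compl ?_
  intro γ hγ
  obtain ⟨β, hβ⟩ : ∃ β : {β : Arrows 𝒢 // β.source = γ.source},
      f (Arrows.comp γ β.1.inv β.2.symm) * g β.1 ≠ 0 := by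
    by_contra! h
    exact hγ (by rw [convolution]; simp [h])
  refine ⟨⟨(Arrows.comp γ β.1.inv β.2.symm, β.1), rfl⟩,
    ⟨fun h => hβ (by simp [h]), fun h => hβ (by simp [h])⟩, ?_⟩
  exact Arrows.comp_inv_comp γ β.1 β.2.symm

theorem convolution_assoc {f g h : Arrows 𝒢 → R} (hg : g ∈ locConst (Arrows 𝒢) R)
    (hh : h ∈ locConst (Arrows 𝒢) R) :
    convolution (convolution f g) h = convolution f (convolution g h) := by
  ext γ
  let T := {β : Arrows 𝒢 // β.source = γ.source}
  let φ : T → T → R := fun δ β => f (Arrows.comp γ β.1.inv β.2.symm) *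
    g (Arrows.comp β.1 δ.1.inv (β.2.trans δ.2.symm)) * h δ.1
  have e1 : ∀ δ : T, convolution f g (Arrows.comp γ δ.1.inv δ.2.symm) * h δ.1 = ∑ᶠ β, φ δ β := by
    intro δ
    rw [convolution, finsum_mul' _ _ (finite_support_convolution f hg.2 _)]
    refine (finsum_eq_of_bijective (fun β : T => ⟨Arrows.comp β.1 δ.1.inv (β.2.trans δ.2.symm),
      rfl⟩) ⟨?_, ?_⟩ ?_).symm
    · intro β β' hb
      have hb' : Arrows.comp β.1 δ.1.inv (β.2.trans δ.2.symm) =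
        Arrows.comp β'.1 δ.1.inv (β'.2.trans δ.2.symm) := congrArg Subtype.val hb
      apply Subtype.ext
      rw [← Arrows.comp_inv_comp β.1 δ.1 (β.2.trans δ.2.symm),
        ← Arrows.comp_inv_comp β'.1 δ.1 (β'.2.trans δ.2.symm)]
      exact Arrows.comp_congr hb' rfl _ _
    · rintro ⟨ε, hε⟩
      refine ⟨⟨Arrows.comp ε δ.1 hε, δ.2⟩, Subtype.ext ?_⟩
      exact Arrows.comp_comp_inv ε δ.1 hε
    · intro β
      have e3 : Arrows.comp (Arrows.comp γ δ.1.inv δ.2.symm)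
          (Arrows.comp β.1 δ.1.inv (β.2.trans δ.2.symm)).inv rfl =
          Arrows.comp γ β.1.inv β.2.symm :=
        Arrows.comp_inv_comp_inv γ β.1 δ.1 δ.2.symm (β.2.trans δ.2.symm)
      change φ δ β = f (Arrows.comp (Arrows.comp γ δ.1.inv δ.2.symm)
          (Arrows.comp β.1 δ.1.inv (β.2.trans δ.2.symm)).inv rfl) * _ * _
      rw [e3]
  have e2 : ∀ β : T, f (Arrows.comp γ β.1.inv β.2.symm) * convolution g h β.1 =
      ∑ᶠ δ, φ δ β := by
    intro β
    rw [convolution, mul_finsum' _ _ (finite_support_convolution g hh.2 _)]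
    refine (finsum_eq_of_bijective (fun δ : T => ⟨δ.1, δ.2.trans β.2.symm⟩) ⟨?_, ?_⟩ ?_).symm
    · intro δ δ' hd
      exact Subtype.ext (Subtype.mk.inj hd)
    · rintro ⟨δ, hδ⟩
      exact ⟨⟨δ, hδ.trans β.2⟩, rfl⟩
    · intro δ
      exact mul_assoc _ _ _
  have hh' : {δ : T | h δ.1 ≠ 0}.Finite := by
    have := (finite_fiber hh.2 γ.source).preimage (f := (Subtype.val : T → Arrows 𝒢))
      Subtype.val_injective.injOn
    exact this.subset fun δ hδ => ⟨hδ, δ.2⟩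
  have hφ : ∀ δ, (Function.support (φ δ)).Finite := by
    intro δ
    have h2 := (finite_fiber hg.2 δ.1.range).preimage
      (f := fun β : T => Arrows.comp β.1 δ.1.inv (β.2.trans δ.2.symm)) (by
        intro β _ β' _ hb
        apply Subtype.ext
        rw [← Arrows.comp_inv_comp β.1 δ.1 (β.2.trans δ.2.symm),
          ← Arrows.comp_inv_comp β'.1 δ.1 (β'.2.trans δ.2.symm)]
        exact Arrows.comp_congr hb rfl _ _)
    exact h2.subset fun β hβ => ⟨fun h0 => hβ (by simp [φ, h0]), rfl⟩
  change ∑ᶠ δ : T, convolution f g (Arrows.comp γ δ.1.inv δ.2.symm) * h δ.1 =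
    ∑ᶠ β : T, f (Arrows.comp γ β.1.inv β.2.symm) * convolution g h β.1
  simp_rw [e1, e2]
  have hz : ∀ δ : T, δ ∉ hh'.toFinset → ∀ β, φ δ β = 0 := by
    intro δ hδ β
    have : h δ.1 = 0 := by simpa using hδ
    simp [φ, this]
  rw [finsum_eq_sum_of_support_subset (s := hh'.toFinset) _ (by
    intro δ hδ
    by_contra hn
    exact hδ (by simp [hz δ hn])), sum_finsum_comm _ _ (fun δ _ => hφ δ)]
  refine finsum_congr fun β => (finsum_eq_sum_of_support_subset _ ?_).symm
  intro δ hδ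
  by_contra hn
  exact hδ (hz δ hn β)

end Convolution

/-- The Steinberg algebra `A_R(𝒢)` of a Hausdorff ample groupoid `𝒢`: the `R`-module of all locally
constant functions `𝒢 → R` with compact support, with the convolution product. (The algebra
structure below only uses that `𝒢` is Hausdorff and étale.) -/
def SteinbergAlgebra (R : Type*) [CommRing R] (𝒢 : Type*) [Groupoid 𝒢]
    [TopologicalSpace (Arrows 𝒢)] : Type _ :=
  (locConst (Arrows 𝒢) R).toSubmodule

namespace SteinbergAlgebra

variable {R : Type*} [CommRing R] {𝒢 : Type*} [Groupoid 𝒢] [TopologicalSpace (Arrows 𝒢)]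

instance : AddCommGroup (SteinbergAlgebra R 𝒢) :=
  inferInstanceAs (AddCommGroup (locConst (Arrows 𝒢) R).toSubmodule)

instance : Module R (SteinbergAlgebra R 𝒢) :=
  inferInstanceAs (Module R (locConst (Arrows 𝒢) R).toSubmodule)

instance : FunLike (SteinbergAlgebra R 𝒢) (Arrows 𝒢) R where
  coe f := f.1
  coe_injective _ _ h := Subtype.ext h

theorem mem (f : SteinbergAlgebra R 𝒢) : ⇑f ∈ locConst (Arrows 𝒢) R := f.2

theorem coe_add (f g : SteinbergAlgebra R 𝒢) : ⇑(f + g) = ⇑f + ⇑g := rfl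

theorem coe_zero : ⇑(0 : SteinbergAlgebra R 𝒢) = 0 := rfl

theorem coe_smul (c : R) (f : SteinbergAlgebra R 𝒢) : ⇑(c • f) = c • ⇑f := rfl

variable [TopologicalSpace 𝒢] [HausdorffEtaleGroupoid 𝒢]

instance : Mul (SteinbergAlgebra R 𝒢) :=
  ⟨fun f g => ⟨convolution f g, convolution_mem f.2 g.2⟩⟩

theorem coe_mul (f g : SteinbergAlgebra R 𝒢) : ⇑(f * g) = convolution f g := rfl

instance : NonUnitalRing (SteinbergAlgebra R 𝒢) where
  left_distrib f g h := by
    apply DFunLike.coe_injective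
    rw [coe_add, coe_mul, coe_mul, coe_mul]
    ext γ
    simp only [convolution, coe_add, Pi.add_apply, mul_add]
    exact finsum_add_distrib (finite_support_convolution f g.mem.2 γ)
      (finite_support_convolution f h.mem.2 γ)
  right_distrib f g h := by
    apply DFunLike.coe_injective
    rw [coe_add, coe_mul, coe_mul, coe_mul]
    ext γ
    simp only [convolution, coe_add, Pi.add_apply, add_mul]
    exact finsum_add_distrib (finite_support_convolution f h.mem.2 γ)
      (finite_support_convolution g h.mem.2 γ)
  zero_mul f := by
    apply DFunLike.coe_injective
    rw [coe_mul, coe_zero]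
    ext γ
    simp [convolution]
  mul_zero f := by
    apply DFunLike.coe_injective
    rw [coe_mul, coe_zero]
    ext γ
    simp [convolution]
  mul_assoc f g h := by
    apply DFunLike.coe_injective
    simp only [coe_mul]
    exact convolution_assoc g.mem h.mem

instance : IsScalarTower R (SteinbergAlgebra R 𝒢) (SteinbergAlgebra R 𝒢) where
  smul_assoc c f g := by
    apply DFunLike.coe_injective
    rw [smul_eq_mul, smul_eq_mul, coe_smul, coe_mul, coe_mul]
    ext γ
    simp only [convolution, coe_smul, Pi.smul_apply, smul_eq_mul]
    rw [mul_finsum' _ _ (finite_support_convolution f g.mem.2 γ)]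
    simp only [mul_assoc]

instance : SMulCommClass R (SteinbergAlgebra R 𝒢) (SteinbergAlgebra R 𝒢) where
  smul_comm c f g := by
    apply DFunLike.coe_injective
    rw [smul_eq_mul, smul_eq_mul, coe_smul, coe_mul, coe_mul]
    ext γ
    simp only [convolution, coe_smul, Pi.smul_apply, smul_eq_mul]
    rw [mul_finsum' _ _ (finite_support_convolution f g.mem.2 γ)]
    simp only [mul_left_comm]

end SteinbergAlgebra

/-! ### The transformation groupoid -/

/-- The objects of the transformation groupoid `C ⋊_θ X`: the pairs `(e, x)` with `e` an object
of `C` and `x ∈ X_e`. -/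
@[ext]
structure TransformationGroupoid {C : Type*} [Groupoid C] {X : Type*} (θ : PartialAction C X) where
  base : C
  pt : X
  pt_mem : pt ∈ θ.carrier (Arrows.unit base)

namespace TransformationGroupoid

section Algebra

variable {C : Type*} [Groupoid C] {X : Type*} {θ : PartialAction C X}

/-- A morphism `(s(t), x) ⟶ (r(t), θ_t(x))` is a morphism `t` of `C` such that `x ∈ X_{t⁻¹}`;
it corresponds to the element `(t, x)` of the transformation groupoid. The product is
`(v, θ_t(x)) (t, x) = (v t, x)`, the inverse is `(t, x)⁻¹ = (t⁻¹, θ_t(x))`. -/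
instance : Groupoid (TransformationGroupoid θ) where
  Hom p q := {t : p.base ⟶ q.base //
    p.pt ∈ θ.carrier (Arrows.inv ⟨p.base, q.base, t⟩) ∧ θ.map ⟨p.base, q.base, t⟩ p.pt = q.pt}
  id p := ⟨𝟙 p.base, by
    change p.pt ∈ θ.carrier (Arrows.unit p.base).inv
    simpa using p.pt_mem, θ.map_unit p.base p.pt p.pt_mem⟩
  comp {p q r} t v := ⟨t.1 ≫ v.1, by
    have h1 := t.2.1
    have h2 : θ.map ⟨p.base, q.base, t.1⟩ p.pt ∈
        θ.carrier (Arrows.inv ⟨q.base, r.base, v.1⟩) := by rw [t.2.2]; exact v.2.1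
    rw [← Arrows.comp_mk v.1 t.1 rfl]
    refine ⟨θ.mem_comp_inv _ h1 h2, ?_⟩
    rw [θ.map_comp _ h1 h2, t.2.2, v.2.2]⟩
  inv {p q} t := ⟨Groupoid.inv t.1, by
    change q.pt ∈ θ.carrier (Arrows.inv (Arrows.inv ⟨p.base, q.base, t.1⟩)) ∧
      θ.map (Arrows.inv ⟨p.base, q.base, t.1⟩) q.pt = p.pt
    rw [Arrows.inv_inv]
    have h1 := θ.map_mem t.2.1
    have h2 := θ.map_inv_map t.2.1
    rw [t.2.2] at h1 h2
    exact ⟨h1, h2⟩⟩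
  id_comp t := Subtype.ext (Category.id_comp t.1)
  comp_id t := Subtype.ext (Category.comp_id t.1)
  assoc t v w := Subtype.ext (Category.assoc t.1 v.1 w.1)
  inv_comp t := Subtype.ext (Groupoid.inv_comp t.1)
  comp_inv t := Subtype.ext (Groupoid.comp_inv t.1)

/-- The component `t` of an element `(t, x)` of the transformation groupoid. -/
def arrow (γ : Arrows (TransformationGroupoid θ)) : Arrows C :=
  ⟨γ.left.base, γ.right.base, γ.hom.1⟩

/-- The component `x` of an element `(t, x)` of the transformation groupoid. -/
def point (γ : Arrows (TransformationGroupoid θ)) : X := γ.left.pt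

theorem point_mem (γ : Arrows (TransformationGroupoid θ)) : point γ ∈ θ.carrier (arrow γ).inv :=
  γ.hom.2.1

/-- The element `(t, x)` of the transformation groupoid, where `x ∈ X_{t⁻¹}`. -/
def mkArrow (t : Arrows C) (x : X) (hx : x ∈ θ.carrier t.inv) : Arrows (TransformationGroupoid θ) where
  left := ⟨t.left, x, θ.mem_unit hx⟩
  right := ⟨t.right, θ.map t x, θ.mem_unit (θ.map_mem hx)⟩
  hom := ⟨t.hom, hx, rfl⟩

variable (θ) in
/-- The set of morphisms of the transformation groupoid is the set of all pairs `(t, x)` with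
`x ∈ X_{t⁻¹}`. -/
def arrowsEquiv : Arrows (TransformationGroupoid θ) ≃ {p : Arrows C × X // p.2 ∈ θ.carrier p.1.inv}
    where
  toFun γ := ⟨(arrow γ, point γ), point_mem γ⟩
  invFun p := mkArrow p.1.1 p.1.2 p.2
  left_inv γ := by
    obtain ⟨⟨a, x, hx⟩, ⟨b, y, hy⟩, ⟨t, ht, h⟩⟩ := γ
    change a ⟶ b at t
    change θ.map ⟨a, b, t⟩ x = y at h
    subst h
    rfl
  right_inv p := rfl

theorem arrow_comp (γ δ : Arrows (TransformationGroupoid θ)) (p : γ.source = δ.range) :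
    arrow (Arrows.comp γ δ p) = Arrows.comp (arrow γ) (arrow δ)
      (congrArg TransformationGroupoid.base p) := by
  obtain ⟨a, b, γ⟩ := γ
  obtain ⟨c, d, δ⟩ := δ
  obtain rfl : a = d := p
  refine (congrArg arrow (Arrows.comp_mk γ δ rfl)).trans ?_
  exact (Arrows.comp_mk γ.1 δ.1 rfl).symm

theorem range_eq (γ : Arrows (TransformationGroupoid θ)) :
    γ.right.pt = θ.map (arrow γ) (point γ) := γ.hom.2.2.symm

end Algebra

section Topology

variable {C : Type*} [Groupoid C] {X : Type*} [TopologicalSpace X] (θ : PartialAction C X)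

/-- The topology on the unit space, induced by the product topology on `C × X`, where `C` is
discrete. -/
instance : TopologicalSpace (TransformationGroupoid θ) :=
  TopologicalSpace.induced (fun p => (p.base, p.pt)) (@instTopologicalSpaceProd C X ⊥ _)

/-- The topology on the set of morphisms `(t, x)`, induced by the product topology, where the
groupoid `C` is discrete. -/
instance : TopologicalSpace (Arrows (TransformationGroupoid θ)) :=
  TopologicalSpace.induced (fun γ => (arrow γ, point γ)) (@instTopologicalSpaceProd (Arrows C) X ⊥ _)

theorem continuous_point : Continuous (point : Arrows (TransformationGroupoid θ) → X) := by
  let _ : TopologicalSpace (Arrows C) := ⊥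
  exact continuous_snd.comp (continuous_induced_dom
    (f := fun γ : Arrows (TransformationGroupoid θ) => (arrow γ, point γ)))

theorem isOpen_arrow (S : Set (Arrows C)) :
    IsOpen {γ : Arrows (TransformationGroupoid θ) | arrow γ ∈ S} := by
  let _ : TopologicalSpace (Arrows C) := ⊥
  have : DiscreteTopology (Arrows C) := ⟨rfl⟩
  have h : Continuous (arrow : Arrows (TransformationGroupoid θ) → Arrows C) :=
    continuous_fst.comp (continuous_induced_dom
      (f := fun γ : Arrows (TransformationGroupoid θ) => (arrow γ, point γ)))
  exact (isOpen_discrete S).preimage h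

theorem continuous_pt : Continuous (pt : TransformationGroupoid θ → X) := by
  let _ : TopologicalSpace C := ⊥
  exact continuous_snd.comp (continuous_induced_dom
    (f := fun p : TransformationGroupoid θ => (p.base, p.pt)))

theorem isOpen_base (S : Set C) : IsOpen {p : TransformationGroupoid θ | p.base ∈ S} := by
  let _ : TopologicalSpace C := ⊥
  have : DiscreteTopology C := ⟨rfl⟩
  have h : Continuous (base : TransformationGroupoid θ → C) :=
    continuous_fst.comp (continuous_induced_dom
      (f := fun p : TransformationGroupoid θ => (p.base, p.pt)))
  exact (isOpen_discrete S).preimage h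

/-- Continuity into the set of morphisms, at a point. -/
theorem continuousAt_arrows {Y : Type*} [TopologicalSpace Y]
    {F : Y → Arrows (TransformationGroupoid θ)} {y : Y}
    (h1 : ∀ᶠ z in 𝓝 y, arrow (F z) = arrow (F y)) (h2 : ContinuousAt (fun z => point (F z)) y) :
    ContinuousAt F y := by
  let _ : TopologicalSpace (Arrows C) := ⊥
  have h : Topology.IsInducing
      (fun γ : Arrows (TransformationGroupoid θ) => (arrow γ, point γ)) := ⟨rfl⟩
  rw [h.continuousAt_iff]
  refine ContinuousAt.prodMk ?_ h2
  exact (continuousAt_const (y := arrow (F y))).congr (h1.mono fun z hz => hz.symm)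

/-- Continuity into the set of objects, at a point. -/
theorem continuousAt_objects {Y : Type*} [TopologicalSpace Y]
    {F : Y → TransformationGroupoid θ} {y : Y}
    (h1 : ∀ᶠ z in 𝓝 y, (F z).base = (F y).base) (h2 : ContinuousAt (fun z => (F z).pt) y) :
    ContinuousAt F y := by
  let _ : TopologicalSpace C := ⊥
  have h : Topology.IsInducing
      (fun p : TransformationGroupoid θ => (p.base, p.pt)) := ⟨rfl⟩
  rw [h.continuousAt_iff]
  refine ContinuousAt.prodMk ?_ h2
  exact (continuousAt_const (y := (F y).base)).congr (h1.mono fun z hz => hz.symm)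

theorem eventually_arrow (γ : Arrows (TransformationGroupoid θ)) :
    ∀ᶠ γ' in 𝓝 γ, arrow γ' = arrow γ :=
  (isOpen_arrow θ {arrow γ}).mem_nhds rfl

theorem eventually_base (p : TransformationGroupoid θ) : ∀ᶠ p' in 𝓝 p, p'.base = p.base :=
  (isOpen_base θ {p.base}).mem_nhds rfl

end Topology

/-- The transformation groupoid of a topological partial action on a Hausdorff space is a Hausdorff
étale groupoid. -/
instance {C : Type*} [Groupoid C] {X : Type*} [TopologicalSpace X] [T2Space X]
    (θ : TopologicalPartialAction C X) :
    HausdorffEtaleGroupoid (TransformationGroupoid θ.toPartialAction) where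
  t2 := by
    let _ : TopologicalSpace (Arrows C) := ⊥
    have : DiscreteTopology (Arrows C) := ⟨rfl⟩
    refine T2Space.of_injective_continuous
      (f := fun γ : Arrows (TransformationGroupoid θ.toPartialAction) => (arrow γ, point γ))
      (fun γ δ h => (arrowsEquiv θ.toPartialAction).injective (Subtype.ext h))
      continuous_induced_dom
  continuous_range := by
    refine continuous_iff_continuousAt.2 fun γ => continuousAt_objects _ ?_ ?_
    · exact (eventually_arrow _ γ).mono fun γ' h => congrArg Quiver.Total.right h
    · have h1 : ContinuousAt (θ.map (arrow γ)) (point γ) :=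
        (θ.continuousOn_carrier _).continuousAt
          ((θ.isOpen_carrier _).mem_nhds (point_mem γ))
      refine (h1.comp (continuous_point θ.toPartialAction).continuousAt).congr ?_
      filter_upwards [eventually_arrow _ γ] with δ hδ
      change θ.map (arrow γ) (point δ) = δ.right.pt
      rw [range_eq, hδ]
  continuous_unit := by
    refine continuous_iff_continuousAt.2 fun p => continuousAt_arrows _ ?_ ?_
    · exact (eventually_base _ p).mono fun p' h => congrArg Arrows.unit h
    · exact (continuous_pt θ.toPartialAction).continuousAt
  continuous_inv := by
    refine continuous_iff_continuousAt.2 fun γ => continuousAt_arrows _ ?_ ?_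
    · exact (eventually_arrow _ γ).mono fun γ' h => congrArg Arrows.inv h
    · have h1 : ContinuousAt (θ.map (arrow γ)) (point γ) :=
        (θ.continuousOn_carrier _).continuousAt
          ((θ.isOpen_carrier _).mem_nhds (point_mem γ))
      refine (h1.comp (continuous_point θ.toPartialAction).continuousAt).congr ?_
      filter_upwards [eventually_arrow _ γ] with δ hδ
      change θ.map (arrow γ) (point δ) = δ.right.pt
      rw [range_eq, hδ]
  continuous_comp := by
    refine continuous_iff_continuousAt.2 fun p => continuousAt_arrows _ ?_ ?_
    · have h1 : ∀ᶠ q in 𝓝 p, arrow q.1.1 = arrow p.1.1 :=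
        (continuous_fst.comp continuous_subtype_val).continuousAt.eventually
          (eventually_arrow _ p.1.1)
      have h2 : ∀ᶠ q in 𝓝 p, arrow q.1.2 = arrow p.1.2 :=
        (continuous_snd.comp continuous_subtype_val).continuousAt.eventually
          (eventually_arrow _ p.1.2)
      filter_upwards [h1, h2] with q h1 h2
      rw [arrow_comp, arrow_comp]
      exact Arrows.comp_congr h1 h2 _ _
    · exact ((continuous_point θ.toPartialAction).comp
        (continuous_snd.comp continuous_subtype_val)).continuousAt
  isLocalHomeomorph_source := by
    have hcont : Continuous
        (Arrows.source : Arrows (TransformationGroupoid θ.toPartialAction) → _) := by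
      refine continuous_iff_continuousAt.2 fun γ => continuousAt_objects _ ?_ ?_
      · exact (eventually_arrow _ γ).mono fun γ' h => congrArg Quiver.Total.left h
      · exact (continuous_point θ.toPartialAction).continuousAt
    have hopen : IsOpenMap
        (Arrows.source : Arrows (TransformationGroupoid θ.toPartialAction) → _) := by
      classical
      refine IsOpenMap.of_nhds_le fun γ S hS => ?_
      let σ : TransformationGroupoid θ.toPartialAction →
          Arrows (TransformationGroupoid θ.toPartialAction) := fun p =>
        if h : p.pt ∈ θ.carrier (arrow γ).inv then mkArrow (arrow γ) p.pt h else γ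
      have hσ : ∀ p (h : p.pt ∈ θ.carrier (arrow γ).inv), σ p = mkArrow (arrow γ) p.pt h :=
        fun p h => dif_pos h
      have hσγ : σ γ.source = γ :=
        (hσ _ (point_mem γ)).trans ((arrowsEquiv θ.toPartialAction).left_inv γ)
      have hev : ∀ᶠ p in 𝓝 γ.source, p.pt ∈ θ.carrier (arrow γ).inv :=
        (continuous_pt θ.toPartialAction).continuousAt.eventually
          ((θ.isOpen_carrier _).mem_nhds (point_mem γ))
      have hcσ : ContinuousAt σ γ.source := by
        refine continuousAt_arrows _ ?_ ?_
        · filter_upwards [hev] with p hp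
          rw [hσγ, hσ p hp]
          rfl
        · refine (continuous_pt θ.toPartialAction).continuousAt.congr ?_
          filter_upwards [hev] with p hp
          rw [hσ p hp]
          rfl
      have hS' : ∀ᶠ p in 𝓝 γ.source, (σ p).source ∈ S := by
        have h1 : ∀ᶠ δ in 𝓝 (σ γ.source), δ.source ∈ S := by rw [hσγ]; exact hS
        exact hcσ.eventually h1
      filter_upwards [hS', hev, eventually_base _ γ.source] with p h1 h2 h3
      rw [hσ p h2] at h1
      convert h1
      exact TransformationGroupoid.ext h3 rfl
    refine isLocalHomeomorph_iff_isOpenEmbedding_restrict.2 fun γ =>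
      ⟨{δ | arrow δ ∈ ({arrow γ} : Set (Arrows C))},
        (isOpen_arrow θ.toPartialAction {arrow γ}).mem_nhds rfl, ?_⟩
    refine Topology.IsOpenEmbedding.of_continuous_injective_isOpenMap
      (hcont.comp continuous_subtype_val) ?_
      (hopen.domRestrict (isOpen_arrow θ.toPartialAction {arrow γ}))
    rintro ⟨δ, hδ⟩ ⟨δ', hδ'⟩ h
    apply Subtype.ext
    refine (arrowsEquiv θ.toPartialAction).injective (Subtype.ext (Prod.ext ?_ ?_))
    · exact (show arrow δ = arrow γ from hδ).trans (show arrow δ' = arrow γ from hδ').symm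
    · exact congrArg TransformationGroupoid.pt h

end TransformationGroupoid

end

/-! The transformation groupoid is the disjoint union of the open bisections `{g} × X_{g⁻¹}`, one
for each arrow `g`, and the range map identifies such a bisection with `X_g` through `(g, x) ↦
θ_g(x)`. A locally constant compactly supported function on the groupoid meets only finitely many
bisections, because `G` is discrete, so it is a finite sum of functions living on single bisections.
Transported along the range map, the piece over `g` is an element of `D_g`. Hence `a δ_g ↦ ((g, x) ↦
a(θ_g(x)))` extends to a linear bijection `toSteinberg`; the formula `toSteinberg_apply` recovers
each coefficient, which gives `toSteinberg_injective`, and cutting a function into slices gives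
`toSteinberg_surjective`.

For products it suffices to treat `a δ_g` and `b δ_h`. In the convolution at `(gh, x)` only the
factorization `(g, θ_h(x)) (h, x)` can contribute, with the value `a(θ_{gh}(x)) b(θ_h(x))`. On the
other side, `α_g(α_{g⁻¹}(a) b)` takes at `y ∈ X_g` the value `a(y) b(θ_{g⁻¹}(y))`, and
`θ_{g⁻¹}(θ_{gh}(x)) = θ_h(x)`. The delicate point is partiality: `x` may lie in `X_{(gh)⁻¹}` but not
in `X_{h⁻¹}`, so that the factorization does not exist. Then `θ_{gh}(x) ∉ X_g`, where `a` vanishes,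
so both sides are zero. This is carried by `map_induced_mul_apply` and
`toSteinberg_single_mul_single`. -/

theorem Arrows.inv_comp_comp {C : Type*} [Groupoid C] (g h : Arrows C) (p : g.source = h.range) :
    Arrows.comp g.inv (Arrows.comp g h p) rfl = h := by
  rw [← Arrows.comp_assoc g.inv g h rfl p]
  exact (Arrows.comp_congr (Arrows.inv_comp_self g) rfl _ p).trans (Arrows.unit_comp h _ p)

/-! ### Factoring `θ_{gh}` through `θ_h` -/

namespace PartialAction

variable {C : Type*} [Groupoid C] {X : Type*} (θ : PartialAction C X)

/-- Axiom (iii) applied to the pair `g⁻¹`, `gh`, whose product is `h`. The contrapositive is what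
gets used: where `(gh, x)` has no factor `(h, x)`, its range lies outside `X_g`. -/
theorem mem_inv_of_map_comp_mem {g h : Arrows C} (p : g.source = h.range) {x : X}
    (hx : x ∈ θ.carrier (Arrows.comp g h p).inv)
    (hy : θ.map (Arrows.comp g h p) x ∈ θ.carrier g) : x ∈ θ.carrier h.inv := by
  have := θ.mem_comp_inv (g := g.inv) (h := Arrows.comp g h p) rfl hx (by simpa using hy)
  rwa [Arrows.inv_comp_comp] at this

/-- Axiom (iv) for the same pair `g⁻¹`, `gh`. The membership `x ∈ X_{h⁻¹}` need not be assumed. -/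
theorem map_inv_map_comp {g h : Arrows C} (p : g.source = h.range) {x : X}
    (hx : x ∈ θ.carrier (Arrows.comp g h p).inv)
    (hy : θ.map (Arrows.comp g h p) x ∈ θ.carrier g) :
    θ.map g.inv (θ.map (Arrows.comp g h p) x) = θ.map h x := by
  rw [← θ.map_comp (g := g.inv) (h := Arrows.comp g h p) rfl hx (by simpa using hy),
    Arrows.inv_comp_comp]

end PartialAction

/-! ### Coefficients of formal sums -/

namespace AlgebraPartialAction.SkewGroupoidRing

variable {R : Type*} [CommRing R] {C : Type*} [Groupoid C] {A : Type*} [NonUnitalRing A]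
  [Module R A] (α : AlgebraPartialAction R C A)

/-- The coefficient `a_g` of the formal sum `∑ a_g δ_g`. -/
def coeff (g : Arrows C) : α.SkewGroupoidRing →ₗ[R] α.D g :=
  DirectSum.component R (Arrows C) (fun g => α.D g) g

theorem coeff_single_self (g : Arrows C) (a : α.D g) : coeff α g (single α g a) = a := by
  classical
  exact DirectSum.component.lof_self (M := fun g => α.D g) R g a

theorem coeff_single_of_ne {g h : Arrows C} (hne : h ≠ g) (a : α.D h) :
    coeff α g (single α h a) = 0 := by
  classical
  exact (DirectSum.component.of (M := fun g => α.D g) R g h a).trans (dif_neg hne)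

theorem ext_coeff {x y : α.SkewGroupoidRing} (h : ∀ g, coeff α g x = coeff α g y) : x = y :=
  DirectSum.ext_component R h

theorem induction_on {P : α.SkewGroupoidRing → Prop} (x : α.SkewGroupoidRing) (zero : P 0)
    (single : ∀ g a, P (single α g a)) (add : ∀ x y, P x → P y → P (x + y)) : P x := by
  classical
  exact DirectSum.induction_on x zero single add

end AlgebraPartialAction.SkewGroupoidRing

/-! ### Bisections of the transformation groupoid -/

namespace TransformationGroupoid

variable {C : Type*} [Groupoid C] {X : Type*} {θ : PartialAction C X}

theorem ext_arrow {γ δ : Arrows (TransformationGroupoid θ)} (h : arrow γ = arrow δ)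
    (h' : point γ = point δ) : γ = δ :=
  (arrowsEquiv θ).injective (Subtype.ext (Prod.ext h h'))

/-- Dividing `(gh, x)` on the right by `(h, x)` leaves an element over `(gh)h⁻¹ = g`. This
identifies the left factor in the only convolution term that can be nonzero. -/
theorem arrow_comp_inv_mkArrow {g h : Arrows C} {p : g.source = h.range}
    {γ : Arrows (TransformationGroupoid θ)} (hγ : arrow γ = Arrows.comp g h p)
    {x : X} (hx : x ∈ θ.carrier h.inv) (q : γ.source = (mkArrow h x hx).source) :
    arrow (Arrows.comp γ (mkArrow h x hx).inv q) = g := by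
  refine (arrow_comp γ (mkArrow h x hx).inv q).trans ?_
  exact (Arrows.comp_congr hγ rfl _ rfl).trans (Arrows.comp_comp_inv g h p)

/-- Follows from `γ = (γβ⁻¹)β`, since `arrow` respects products. Its purpose is the vanishing case:
a nonzero convolution term at `γ` forces `γ` to lie over `gh`. -/
theorem arrow_eq_comp_of_arrow_comp_inv {γ β : Arrows (TransformationGroupoid θ)}
    (q : γ.source = β.source) :
    arrow γ = Arrows.comp (arrow (Arrows.comp γ β.inv q)) (arrow β) rfl := by
  rw [← arrow_comp _ _ rfl, Arrows.comp_inv_comp]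

/-- The bisection `{t} × X_{t⁻¹}`, parametrized by the range. -/
def ofRange (θ : PartialAction C X) (t : Arrows C) (y : θ.carrier t) :
    Arrows (TransformationGroupoid θ) :=
  mkArrow t (θ.map t.inv y) (θ.map_inv_mem y.2)

/-- Together with `ofRange_arrow`, this says that `ofRange` inverts the range map on the bisection
over `t`. -/
theorem ofRange_right_pt (t : Arrows C) (y : θ.carrier t) :
    (ofRange θ t y).right.pt = y := θ.map_map_inv y.2

theorem right_pt_mem (γ : Arrows (TransformationGroupoid θ)) :
    γ.right.pt ∈ θ.carrier (arrow γ) := by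
  rw [range_eq]
  exact θ.map_mem (point_mem γ)

theorem ofRange_arrow (γ : Arrows (TransformationGroupoid θ)) :
    ofRange θ (arrow γ) ⟨γ.right.pt, right_pt_mem γ⟩ = γ := by
  refine ext_arrow rfl ?_
  change θ.map (arrow γ).inv γ.right.pt = point γ
  rw [range_eq, θ.map_inv_map (point_mem γ)]

section Topology

variable [TopologicalSpace X]

/-- The projection to the discrete set of arrows is continuous, so a compact set has finite image.
This is why the slices of a compactly supported function form a finite formal sum. -/
theorem finite_image_arrow {K : Set (Arrows (TransformationGroupoid θ))} (hK : IsCompact K) :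
    (arrow '' K).Finite := by
  let _ : TopologicalSpace (Arrows C) := ⊥
  have : DiscreteTopology (Arrows C) := ⟨rfl⟩
  exact (hK.image (f := arrow) (continuous_def.2 fun S _ => isOpen_arrow θ S)).finite_of_discrete

variable (θ : TopologicalPartialAction C X)

theorem continuous_ofRange (t : Arrows C) : Continuous (ofRange θ.toPartialAction t) := by
  refine continuous_iff_continuousAt.2 fun y =>
    continuousAt_arrows _ (Filter.Eventually.of_forall fun _ => rfl) ?_
  have h : ContinuousOn (θ.map t.inv) (θ.carrier t) := by
    simpa using θ.continuousOn_carrier t.inv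
  exact h.domRestrict.continuousAt

variable [T2Space X]

theorem continuous_right_pt :
    Continuous fun γ : Arrows (TransformationGroupoid θ.toPartialAction) => γ.right.pt :=
  (continuous_pt _).comp HausdorffEtaleGroupoid.continuous_range

end Topology

end TransformationGroupoid

/-! ### Functions on one bisection and functions on `X_g` -/

namespace TopologicalPartialAction

open TransformationGroupoid AlgebraPartialAction

variable {C : Type*} [Groupoid C] {X : Type*} [TopologicalSpace X]
  {R : Type*} [CommRing R] (θ : TopologicalPartialAction C X)

open Classical in
/-- The function `(t, x) ↦ a (θ_t x)` on `{g} × X_{g⁻¹}`, extended by zero. -/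
noncomputable def homogeneousFun (g : Arrows C) (a : X → R)
    (γ : Arrows (TransformationGroupoid θ.toPartialAction)) : R :=
  if arrow γ = g then a γ.right.pt else 0

theorem homogeneousFun_of_eq {g : Arrows C} (a : X → R)
    {γ : Arrows (TransformationGroupoid θ.toPartialAction)} (h : arrow γ = g) :
    θ.homogeneousFun g a γ = a γ.right.pt := if_pos h

theorem homogeneousFun_of_ne {g : Arrows C} (a : X → R)
    {γ : Arrows (TransformationGroupoid θ.toPartialAction)} (h : arrow γ ≠ g) :
    θ.homogeneousFun g a γ = 0 := if_neg h

open Classical in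
/-- The function `y ↦ f (g, θ_{g⁻¹} y)` on `X_g`, extended by zero. -/
noncomputable def sliceFun (g : Arrows C)
    (f : Arrows (TransformationGroupoid θ.toPartialAction) → R)
    (y : X) : R :=
  if hy : y ∈ θ.carrier g then f (ofRange θ.toPartialAction g ⟨y, hy⟩) else 0

theorem support_sliceFun_subset (g : Arrows C)
    (f : Arrows (TransformationGroupoid θ.toPartialAction) → R) :
    Function.support (θ.sliceFun g f) ⊆ θ.carrier g := by
  intro y hy
  by_contra h
  exact hy (dif_neg h)

variable [T2Space X]

/-- The point `x` is not required to lie in `X_{h⁻¹}`. If it does not, `θ.map h x` is an irrelevant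
value, but the formula survives because the factor coming from `a` is zero. -/
theorem map_induced_mul_apply {g h : Arrows C} (p : g.source = h.range)
    (a : (θ.induced R).D g) (b : (θ.induced R).D h) {x : X}
    (hx : x ∈ θ.carrier (Arrows.comp g h p).inv) :
    (((θ.induced R).map g ((θ.induced R).map g.inv a * b) : locConst X R) : X → R)
        (θ.map (Arrows.comp g h p) x) =
      (a : locConst X R).1 (θ.map (Arrows.comp g h p) x) *
        (b : locConst X R).1 (θ.map h x) := by
  have h1 : (a : locConst X R) ∈ θ.inducedIdeal R g.inv.inv := by
    rw [Arrows.inv_inv]; exact a.2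
  have h2 := ((θ.induced R).map_inv_mul_mem p a.2 b.2).1
  refine (congrFun (θ.coe_inducedMap h2) _).trans ?_
  by_cases hy : θ.map (Arrows.comp g h p) x ∈ θ.carrier g
  · rw [inducedFun_apply_of_mem θ _ hy, θ.map_inv_map_comp p hx hy]
    change (θ.inducedMap R g.inv a : X → R) _ * _ = _
    -- Writing `θ_h(x)` as `θ_{g⁻¹}(y)` with `y = θ_{gh}(x)` makes `α_{g⁻¹}(a)` return `a(y)`.
    rw [θ.coe_inducedMap h1, ← θ.map_inv_map_comp p hx hy,
      inducedFun_map θ _ (by simpa using hy)]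
  · rw [inducedFun_apply_of_not_mem θ _ hy,
      Function.notMem_support.1 fun h => hy (a.2 h), zero_mul]

/-- Local constancy holds because `arrow` is locally constant and the range map is continuous. The
support is the image of the support of `a` under the continuous section `ofRange`, hence compact. -/
theorem homogeneousFun_mem {g : Arrows C} {a : X → R} (ha : a ∈ locConst X R)
    (hs : Function.support a ⊆ θ.carrier g) :
    θ.homogeneousFun g a ∈ locConst (Arrows (TransformationGroupoid θ.toPartialAction)) R := by
  refine ⟨(IsLocallyConstant.iff_eventually_eq _).2 fun γ => ?_, ?_⟩
  · filter_upwards [eventually_arrow _ γ,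
      (continuous_right_pt θ).continuousAt.eventually (ha.1.eventually_eq γ.right.pt)] with δ h h'
    rw [homogeneousFun, homogeneousFun, h, h']
  -- Since the support of `a` is contained in `X_g`, it remains compact as a subset of the subspace
  -- `X_g`, the domain of `ofRange`.
  · have hK : IsCompact ((Subtype.val : θ.carrier g → X) ⁻¹' Function.support a) :=
      Topology.IsInducing.subtypeVal.isCompact_preimage' ha.2 (by simpa using hs)
    convert hK.image (continuous_ofRange θ g) using 1
    ext γ
    constructor
    · intro hγ
      have h : arrow γ = g := by
        by_contra h
        exact hγ (θ.homogeneousFun_of_ne a h)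
      subst h
      exact ⟨⟨γ.right.pt, right_pt_mem γ⟩, by
        rwa [Function.mem_support, θ.homogeneousFun_of_eq a rfl] at hγ, ofRange_arrow γ⟩
    · rintro ⟨y, hy, rfl⟩
      rw [Function.mem_support, θ.homogeneousFun_of_eq (g := g) (γ := ofRange θ.toPartialAction g y) a rfl,
        ofRange_right_pt]
      exact hy

variable (R) in
/-- The linear map `a δ_g ↦ ((t, x) ↦ a (θ_t x))`. -/
noncomputable def homogeneousMap (g : Arrows C) : (θ.induced R).D g →ₗ[R]
    SteinbergAlgebra R (TransformationGroupoid θ.toPartialAction) where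
  toFun a := ⟨θ.homogeneousFun g (a : locConst X R), θ.homogeneousFun_mem a.1.2 a.2⟩
  map_add' a b := by
    apply DFunLike.coe_injective
    ext γ
    change θ.homogeneousFun g (a.1.1 + b.1.1) γ =
      θ.homogeneousFun g a.1.1 γ + θ.homogeneousFun g b.1.1 γ
    by_cases h : arrow γ = g <;> simp [homogeneousFun, h]
  map_smul' c a := by
    apply DFunLike.coe_injective
    ext γ
    change θ.homogeneousFun g (c • a.1.1) γ = c • θ.homogeneousFun g a.1.1 γ
    by_cases h : arrow γ = g <;> simp [homogeneousFun, h]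

variable (R) in
/-- The linear map `∑ a_g δ_g ↦ ((t, x) ↦ a_t (θ_t x))`. -/
noncomputable def toSteinberg : (θ.induced R).SkewGroupoidRing →ₗ[R]
    SteinbergAlgebra R (TransformationGroupoid θ.toPartialAction) :=
  SkewGroupoidRing.lift _ (θ.homogeneousMap R)

/-- The value at `γ` sees only the coefficient at the arrow of `γ`. By linearity it is enough to
check this on homogeneous elements. -/
theorem toSteinberg_apply (x : (θ.induced R).SkewGroupoidRing)
    (γ : Arrows (TransformationGroupoid θ.toPartialAction)) :
    θ.toSteinberg R x γ =
      (SkewGroupoidRing.coeff _ (arrow γ) x : locConst X R).1 γ.right.pt := by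
  induction x using SkewGroupoidRing.induction_on with
  | zero => simp only [map_zero]; rfl
  | add x y hx hy => simp only [_root_.map_add, SteinbergAlgebra.coe_add, Pi.add_apply, hx, hy]; rfl
  | single g a =>
    rw [toSteinberg, SkewGroupoidRing.lift_single]
    by_cases h : arrow γ = g
    · subst h
      rw [SkewGroupoidRing.coeff_single_self]
      exact θ.homogeneousFun_of_eq _ rfl
    · rw [SkewGroupoidRing.coeff_single_of_ne _ (Ne.symm h)]
      exact θ.homogeneousFun_of_ne _ h

theorem toSteinberg_single_apply_of_eq {g : Arrows C} (a : (θ.induced R).D g)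
    {γ : Arrows (TransformationGroupoid θ.toPartialAction)} (h : arrow γ = g) :
    θ.toSteinberg R (SkewGroupoidRing.single _ g a) γ = (a : locConst X R).1 γ.right.pt := by
  subst h
  rw [toSteinberg_apply, SkewGroupoidRing.coeff_single_self]

theorem toSteinberg_single_apply_of_ne {g : Arrows C} (a : (θ.induced R).D g)
    {γ : Arrows (TransformationGroupoid θ.toPartialAction)} (h : arrow γ ≠ g) :
    θ.toSteinberg R (SkewGroupoidRing.single _ g a) γ = 0 := by
  rw [toSteinberg_apply, SkewGroupoidRing.coeff_single_of_ne _ h.symm]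
  rfl

/-! ### Bijectivity -/

theorem toSteinberg_injective : Function.Injective (θ.toSteinberg R) := by
  refine (injective_iff_map_eq_zero _).2 fun x hx => SkewGroupoidRing.ext_coeff _ fun g => ?_
  rw [map_zero]
  refine Subtype.ext (Subtype.ext (funext fun y => ?_))
  by_cases hy : y ∈ θ.carrier g
  -- Evaluation at the element over `g` with range `y` reads off the value at `y` of the coefficient
  -- at `g`; outside `X_g` this coefficient vanishes, being in `D_g`.
  · have h := θ.toSteinberg_apply x (ofRange θ.toPartialAction g ⟨y, hy⟩)
    rw [hx, ofRange_right_pt] at h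
    exact h.symm
  · exact Function.notMem_support.1 fun h => hy ((SkewGroupoidRing.coeff _ g x).2 h)

theorem sliceFun_mem {g : Arrows C} (hg : IsClopen (θ.carrier g))
    {f : Arrows (TransformationGroupoid θ.toPartialAction) → R}
    (hf : f ∈ locConst (Arrows (TransformationGroupoid θ.toPartialAction)) R) :
    θ.sliceFun g f ∈ locConst X R := by
  refine ⟨(IsLocallyConstant.iff_eventually_eq _).2 fun y => ?_, ?_⟩
  · by_cases hy : y ∈ θ.carrier g
    · have h := (hf.1.comp_continuous (continuous_ofRange θ g)).eventually_eq ⟨y, hy⟩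
      -- Local constancy on the subspace `X_g` is turned into a statement on `X`, using that `X_g`
      -- is a neighbourhood of `y`.
      rw [nhds_subtype_eq_comap, Filter.eventually_comap] at h
      filter_upwards [h, hg.2.mem_nhds hy] with z hz hzg
      rw [sliceFun, sliceFun, dif_pos hy, dif_pos hzg]
      exact hz ⟨z, hzg⟩ rfl
    -- Here `X_g` is used as a closed set: extension by zero is constant on its open complement.
    · filter_upwards [hg.1.isOpen_compl.mem_nhds hy] with z hz
      rw [sliceFun, sliceFun, dif_neg hy, dif_neg hz]
  · have hc : IsClosed {γ : Arrows (TransformationGroupoid θ.toPartialAction) | arrow γ = g} :=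
      ⟨isOpen_arrow _ {g}ᶜ⟩
    -- The support of the slice is the image under the range map of the part of the support of `f`
    -- over `g`, a closed subset of a compact set.
    convert (hf.2.inter_right hc).image (continuous_right_pt θ) using 1
    ext y
    constructor
    · intro hy
      have hyg := θ.support_sliceFun_subset g f hy
      rw [Function.mem_support, sliceFun, dif_pos hyg] at hy
      exact ⟨_, ⟨hy, rfl⟩, ofRange_right_pt g ⟨y, hyg⟩⟩
    · rintro ⟨γ, ⟨hγ, rfl⟩, rfl⟩
      rw [Function.mem_support, sliceFun, dif_pos (right_pt_mem γ), ofRange_arrow]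
      exact hγ

theorem toSteinberg_surjective (hclopen : ∀ g : Arrows C, IsClopen (θ.carrier g)) :
    Function.Surjective (θ.toSteinberg R) := by
  intro f
  let b : ∀ g, (θ.induced R).D g := fun g =>
    ⟨⟨θ.sliceFun g f, θ.sliceFun_mem (hclopen g) f.mem⟩, θ.support_sliceFun_subset g f⟩
  have hfin := finite_image_arrow f.mem.2
  -- Only arrows over which `f` is not identically zero are needed.
  refine ⟨∑ g ∈ hfin.toFinset, SkewGroupoidRing.single _ g (b g), ?_⟩
  apply DFunLike.coe_injective
  ext γ
  have hb : (b (arrow γ) : locConst X R).1 γ.right.pt = f γ :=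
    (dif_pos (right_pt_mem γ)).trans (congrArg f (ofRange_arrow γ))
  rw [toSteinberg_apply, map_sum]
  by_cases h : arrow γ ∈ hfin.toFinset
  · rw [Finset.sum_eq_single_of_mem _ h
      fun g _ hg => SkewGroupoidRing.coeff_single_of_ne _ hg _,
      SkewGroupoidRing.coeff_single_self, hb]
  · rw [Finset.sum_eq_zero fun g hg =>
      SkewGroupoidRing.coeff_single_of_ne _ (ne_of_mem_of_not_mem hg h) _]
    have h0 : f γ = 0 := by
      by_contra h0
      exact h (hfin.mem_toFinset.2 ⟨γ, h0, rfl⟩)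
    exact h0.symm

/-! ### Multiplicativity -/

theorem toSteinberg_single_mul_single (g h : Arrows C) (a : (θ.induced R).D g)
    (b : (θ.induced R).D h) :
    θ.toSteinberg R (SkewGroupoidRing.single _ g a * SkewGroupoidRing.single _ h b) =
      θ.toSteinberg R (SkewGroupoidRing.single _ g a) *
        θ.toSteinberg R (SkewGroupoidRing.single _ h b) := by
  apply DFunLike.coe_injective
  ext γ
  rw [SteinbergAlgebra.coe_mul, convolution]
  -- Either `γ` lies over `gh`, or both sides vanish at `γ`.
  by_cases hγ : ∃ p : g.source = h.range, arrow γ = Arrows.comp g h p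
  · obtain ⟨p, hγ⟩ := hγ
    have hx : point γ ∈ θ.carrier (Arrows.comp g h p).inv := hγ ▸ point_mem γ
    have hr : γ.right.pt = θ.map (Arrows.comp g h p) (point γ) := by rw [range_eq, hγ]
    rw [SkewGroupoidRing.single_mul_single_of_composable _ g h p,
      toSteinberg_single_apply_of_eq θ _ hγ, hr]
    refine (θ.map_induced_mul_apply p a b hx).trans ?_
    by_cases hxh : point γ ∈ θ.carrier h.inv
    · have hs : γ.source = (mkArrow h (point γ) hxh).source :=
        TransformationGroupoid.ext (congrArg Quiver.Total.left hγ) rfl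
      -- The factor from `b` restricts to `β` over `h`, and such a `β` with the source of `γ` must
      -- be `(h, x)` for `x = point γ`. The left factor `γβ⁻¹` has the same range as `γ`, so `a` is
      -- evaluated at `θ_{gh}(x)`.
      rw [finsum_eq_single _ ⟨mkArrow h (point γ) hxh, hs.symm⟩]
      · rw [toSteinberg_single_apply_of_eq θ a (arrow_comp_inv_mkArrow hγ hxh hs),
          toSteinberg_single_apply_of_eq θ b rfl, ← hr]
        rfl
      · intro β hβ
        rw [toSteinberg_single_apply_of_ne θ b, mul_zero]
        intro hβh
        have hpt : point β.1 = point γ := congrArg TransformationGroupoid.pt β.2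
        exact hβ (Subtype.ext (ext_arrow hβh hpt))
    -- When `x ∉ X_{h⁻¹}`, no `β` over `h` has the source of `γ`, so the convolution is zero; on the
    -- other side `θ_{gh}(x) ∉ X_g` and `a` vanishes there.
    · rw [finsum_eq_zero_of_forall_eq_zero,
        Function.notMem_support.1 fun h' => hxh (θ.mem_inv_of_map_comp_mem p hx (a.2 h')), zero_mul]
      intro β
      rw [toSteinberg_single_apply_of_ne θ b, mul_zero]
      intro hβh
      have hβ := point_mem β.1
      rw [hβh, show point β.1 = point γ from congrArg TransformationGroupoid.pt β.2] at hβ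
      exact hxh hβ
  · rw [finsum_eq_zero_of_forall_eq_zero]
    · by_cases p : g.source = h.range
      · rw [SkewGroupoidRing.single_mul_single_of_composable _ g h p,
          toSteinberg_single_apply_of_ne θ _ fun e => hγ ⟨p, e⟩]
      · rw [SkewGroupoidRing.single_mul_single_of_not _ g h p, map_zero]
        rfl
    · intro β
      by_cases hβ : arrow β.1 = h
      · rw [toSteinberg_single_apply_of_ne θ a, zero_mul]
        -- A term nonzero in both factors has `γβ⁻¹` over `g` and `β` over `h`; then `g` and `h` are
        -- composable and `γ` lies over `gh`, contrary to `hγ`.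
        rintro rfl
        subst hβ
        exact hγ ⟨rfl, arrow_eq_comp_of_arrow_comp_inv β.2.symm⟩
      · rw [toSteinberg_single_apply_of_ne θ b hβ, mul_zero]

theorem toSteinberg_mul (x y : (θ.induced R).SkewGroupoidRing) :
    θ.toSteinberg R (x * y) = θ.toSteinberg R x * θ.toSteinberg R y := by
  induction x using SkewGroupoidRing.induction_on with
  | zero => simp only [zero_mul, map_zero]
  | add x x' hx hx' => simp only [add_mul, _root_.map_add, hx, hx']
  | single g a =>
    induction y using SkewGroupoidRing.induction_on with
    | zero => simp only [mul_zero, map_zero]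
    | add y y' hy hy' => simp only [mul_add, _root_.map_add, hy, hy']
    | single h b => exact θ.toSteinberg_single_mul_single g h a b

end TopologicalPartialAction

theorem mainTheorem12 {R : Type*} [CommRing R] {C : Type*} [Groupoid C]
    {X : Type*} [TopologicalSpace X] [LocallyCompactSpace X] [T2Space X]
    (hX : TopologicalSpace.IsTopologicalBasis {U : Set X | IsClopen U})
    (θ : TopologicalPartialAction C X)
    (hclopen : ∀ g : Arrows C, IsClopen (θ.carrier g))
    (hcover : ⋃ e : C, θ.carrier (Arrows.unit e) = Set.univ)
    (hdisjoint : Pairwise fun e f : C =>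
      Disjoint (θ.carrier (Arrows.unit e)) (θ.carrier (Arrows.unit f))) :
    ∃ φ : (θ.induced R).SkewGroupoidRing →ₙₐ[R]
        SteinbergAlgebra R (TransformationGroupoid θ.toPartialAction),
      Function.Bijective φ := by
  exact ⟨{ θ.toSteinberg R with
      map_zero' := map_zero _
      map_mul' := θ.toSteinberg_mul },
    θ.toSteinberg_injective, θ.toSteinberg_surjective hclopen⟩
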